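/- For $n,k\ge 1$ with $nk$ even and $n>k$, let $\mathcal G_{n,k}$ denote the uniform distribution on the set of all $k$-regular simple graphs on the vertex set $[n]$. For fixed $k$, a property holds for $G\sim\mathcal G_{n,k}$ *with high probability (whp)* if its probability tends to $1$ as $n\to\infty$ along those $n$ for which $nk$ is even. For a graph $G=(V,E)$ and (not necessarily disjoint) sets $A,B\subseteq V$, let $G[A,B]$ be the graph with vertex set $A\cup B$ whose edges are the edges of $G$ having one endpoint in $A$ and the other in $B$ (so $G[A,A]$ is the subgraph induced by $A$). A *strong $d$-rigid partition* of $G$ is a partition $V=V_1\cup\dots\cup V_d$ into $d$ pairwise disjoint non-empty sets such that $G[V_i,V_j]$ is connected for all $1\le i\le j\le d$. For an injective map $\mathbf p:V\to\mathbb R^d$, the rigidity matrix $\mathsf R(G,\mathbf p)\in\mathbb R^{|E|\times d|V|}$ has one row for each edge and $d$ columns for each vertex; the row of $\{u,v\}$ equals $\mathbf p(u)-\mathbf p(v)$ on the columns of $u$, $\mathbf p(v)-\mathbf p(u)$ on the columns of $v$, and $0$ elsewhere. A finite graph $G$ with $|V|\ge d+1$ is *$d$-rigid* if there is an injective $\mathbf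 p:V\to\mathbb R^d$ with $\operatorname{rank}\mathsf R(G,\mathbf p)=d|V|-\binom{d+1}{2}$. **Theorem.** There exists an absolute constant $C>0$ such that for every fixed pair of integers $d\ge 2$ and $k\ge C\,d\log d$ (natural logarithm), a random $k$-regular graph $G\sim\mathcal G_{n,k}$ whp admits a strong $d$-rigid partition; in particular, $G$ is whp $d$-rigid. -/

import Mathlib

namespace RigidPartition

/-- `G[A, B]`: the graph on the vertex set `A ∪ B` whose edges are the edges of `G` with one endpoint
in `A` and the other in `B`. The sets need not be disjoint, and `G[A, A]` is the induced graph. -/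
def bipInduce {V : Type*} (G : SimpleGraph V) (A B : Set V) :
    SimpleGraph (A ∪ B : Set V) :=
  (G.between A B).induce (A ∪ B)

/-- The sets `P 0, …, P (d - 1)` form a (type I) strong `d`-rigid partition of `G`. -/
structure IsStrongRigidPartition {V : Type*} (G : SimpleGraph V) (d : ℕ) (P : Fin d → Set V) :
    Prop where
  nonempty : ∀ i, (P i).Nonempty
  disjoint : ∀ i j, i ≠ j → Disjoint (P i) (P j)
  cover : ⋃ i, P i = Set.univ
  connected : ∀ i j, i ≤ j → (bipInduce G (P i) (P j)).Connected

/-- `G` admits a strong `d`-rigid partition. -/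
def AdmitsStrongRigidPartition {V : Type*} (G : SimpleGraph V) (d : ℕ) : Prop :=
  ∃ P : Fin d → Set V, IsStrongRigidPartition G d P

/-- The rigidity matrix of the framework `(G, p)`. Its rows are indexed by the edges, its columns by
pairs (vertex, coordinate); the row of `{u, v}` is `p u - p v` at `u`, `p v - p u` at `v`, and zero
elsewhere. -/
def rigidityMatrix {V : Type*} [DecidableEq V] (G : SimpleGraph V) {d : ℕ} (p : V → Fin d → ℝ) :
    Matrix G.edgeSet (V × Fin d) ℝ :=
  fun e x => Sym2.lift
    ⟨fun u v => if x.1 = u then p u x.2 - p v x.2 else if x.1 = v then p v x.2 - p u x.2 else 0, by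
      intro u v
      dsimp only
      split_ifs with h₁ h₂
      · rw [← h₁, ← h₂]
      · rfl
      · rfl
      · rfl⟩ (e : Sym2 V)

open Classical in
/-- The framework `(G, p)` is infinitesimally rigid: the rigidity matrix has rank
`d |V| - (d + 1).choose 2`. -/
def InfinitesimallyRigid {V : Type*} [Fintype V] (G : SimpleGraph V) {d : ℕ}
    (p : V → Fin d → ℝ) : Prop :=
  (rigidityMatrix G p).rank + (d + 1).choose 2 = d * Fintype.card V

/-- `G` (on at least `d + 1` vertices) is `d`-rigid: some injective placement of its vertices in
`ℝ ^ d` gives an infinitesimally rigid framework. -/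
def IsRigid {V : Type*} [Fintype V] (G : SimpleGraph V) (d : ℕ) : Prop :=
  d + 1 ≤ Fintype.card V ∧ ∃ p : V ↪ (Fin d → ℝ), InfinitesimallyRigid G p

open Classical in
/-- The set of all `k`-regular simple graphs on the vertex set `Fin n`. -/
def regularGraphs (n k : ℕ) : Set (SimpleGraph (Fin n)) :=
  {G | G.IsRegularOfDegree k}

/-- The probability that a uniformly random `k`-regular graph on `Fin n` has the property `Q`: the
number of `k`-regular graphs with `Q` over the number of all `k`-regular graphs. -/
noncomputable def regularProb (n k : ℕ) (Q : SimpleGraph (Fin n) → Prop) : ℝ :=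
  ({G | G ∈ regularGraphs n k ∧ Q G}.ncard : ℝ) / ((regularGraphs n k).ncard : ℝ)

/-- A property of graphs holds with high probability for the random `k`-regular graph: its
probability tends to `1` as `n → ∞` along those `n` for which `n * k` is even. -/
def RegularWhp (k : ℕ) (Q : ∀ n : ℕ, SimpleGraph (Fin n) → Prop) : Prop :=
  Filter.Tendsto (fun n => regularProb n k (Q n))
    (Filter.atTop ⊓ Filter.principal {n : ℕ | Even (n * k)}) (nhds 1)

end RigidPartition

/-! Rigidity from the partition: place the vertices of the `i`-th class near the basis vector `e_i`,
at `(1 + t y v) e_i`. After dividing the rows of edges inside classes by `t` and letting `t → 0`, a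
velocity `m` is in the kernel when `m (·, i)` is constant along edges inside class `i` and `m (·, i)
- m (·, j)` is constant along edges between classes `i` and `j`. Connectedness of all the pieces
leaves at most `d + d.choose 2 = (d + 1).choose 2` free parameters. Rank is lower semicontinuous, so
some small `t > 0` has at least the limiting rank; translations and rotations show that the rank
cannot be larger.

Existence of the partition: take `δ` of order `k / d` and `w` of order `n / d`. Two pseudorandom
properties suffice: small sets span few edges (`LocallySparse`), and two disjoint `w`-sets always
have an edge between them (`Joined`). The local lemma gives a `d`-colouring in which every vertex
has at least `δ` neighbours of each colour. If a piece between colours `i` and `j` were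
disconnected, each side of the cut would inherit these degrees, hence by sparsity contain at least
`w` vertices of each colour; colour `i` on one side and colour `j` on the other then contradict
`Joined`.

Both properties hold whp by first moment bounds, with probabilities controlled by switchings, that
is, replacing edges `xa`, `yb` by `xy`, `ab` and double counting. There are at most `(O(d)) ^ (2 w)`
pairs of `w`-sets, and each pair is edgeless with probability `exp (-Ω(δ w))`. The union bound
therefore needs `δ` at least of order `log d`, which is `k ≥ C d log d`; the local lemma needs no
more than this. -/

namespace RigidPartition

/-! ### Strong rigid partitions imply rigidity -/

section Rigidity

variable {V : Type*} {d : ℕ}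

open Classical in
/-- For `t ≠ 0`, the rigidity matrix of the placement `v ↦ (1 + t y v) e_{c v}` with the rows of
the monochromatic edges divided by `t`; for `t = 0`, the limit of these matrices. -/
noncomputable def scaledMatrix (G : SimpleGraph V) (c : V → Fin d) (y : V → ℝ) (t : ℝ) :
    Matrix (G.edgeSet) (V × Fin d) ℝ :=
  fun e x =>
    let u := (Quot.out (e : Sym2 V)).1
    let v := (Quot.out (e : Sym2 V)).2
    if c u = c v then
      (if x.1 = u then 1 else if x.1 = v then -1 else 0) * (y u - y v) *
        (Pi.single (c u) 1 : Fin d → ℝ) x.2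
    else
      (if x.1 = u then 1 else if x.1 = v then -1 else 0) *
        ((Pi.single (c u) (1 + t * y u) : Fin d → ℝ) x.2 -
          (Pi.single (c v) (1 + t * y v) : Fin d → ℝ) x.2)

open Classical in
theorem rigidityMatrix_apply (G : SimpleGraph V) (p : V → Fin d → ℝ) (e : G.edgeSet)
    (x : V × Fin d) :
    rigidityMatrix G p e x =
      (if x.1 = (Quot.out (e : Sym2 V)).1 then 1 else
        if x.1 = (Quot.out (e : Sym2 V)).2 then -1 else 0) *
      (p (Quot.out (e : Sym2 V)).1 x.2 - p (Quot.out (e : Sym2 V)).2 x.2) := by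
  have h : (e : Sym2 V) = s((Quot.out (e : Sym2 V)).1, (Quot.out (e : Sym2 V)).2) :=
    (Quot.out_eq (e : Sym2 V)).symm
  unfold rigidityMatrix
  conv_lhs => rw [h]
  simp only [Sym2.lift_mk]
  split_ifs <;> ring

open Classical in
theorem sum_incidence_mul [Fintype V] {u v : V} (huv : u ≠ v) (a : Fin d → ℝ) (m : V × Fin d → ℝ) :
    ∑ x : V × Fin d, (if x.1 = u then (1 : ℝ) else if x.1 = v then -1 else 0) * a x.2 * m x =
      ∑ l, a l * (m (u, l) - m (v, l)) := by
  rw [Fintype.sum_prod_type, Finset.sum_comm]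
  refine Finset.sum_congr rfl fun l _ => ?_
  have : ∀ x : V, (if x = u then (1 : ℝ) else if x = v then -1 else 0) * a l * m (x, l) =
      (if x = u then a l * m (u, l) else 0) + (if x = v then - (a l * m (v, l)) else 0) := by
    intro x
    by_cases h1 : x = u
    · subst h1; simp [huv]
    · by_cases h2 : x = v
      · subst h2; simp [h1]
      · simp [h1, h2]
  simp only [this, Finset.sum_add_distrib, Finset.sum_ite_eq', Finset.mem_univ, if_true]
  ring

theorem out_adj {G : SimpleGraph V} (e : G.edgeSet) :
    G.Adj (Quot.out (e : Sym2 V)).1 (Quot.out (e : Sym2 V)).2 := by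
  have h : (e : Sym2 V) = s((Quot.out (e : Sym2 V)).1, (Quot.out (e : Sym2 V)).2) :=
    (Quot.out_eq (e : Sym2 V)).symm
  have := e.2
  rw [h] at this
  exact this

open Classical in
/-- The velocities in the kernel of the rigidity matrix are the infinitesimal motions. -/
theorem rigidityMatrix_mulVec_eq_zero_iff [Fintype V] (G : SimpleGraph V) (p : V → Fin d → ℝ)
    (m : V × Fin d → ℝ) :
    (rigidityMatrix G p).mulVec m = 0 ↔
      ∀ u v, G.Adj u v → ∑ l, (p u l - p v l) * (m (u, l) - m (v, l)) = 0 := by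
  have key : ∀ e : G.edgeSet, (rigidityMatrix G p).mulVec m e =
      ∑ l, (p (Quot.out (e : Sym2 V)).1 l - p (Quot.out (e : Sym2 V)).2 l) *
        (m ((Quot.out (e : Sym2 V)).1, l) - m ((Quot.out (e : Sym2 V)).2, l)) := by
    intro e
    rw [← sum_incidence_mul (out_adj e).ne]
    simp only [Matrix.mulVec, dotProduct, rigidityMatrix_apply]
  constructor
  · intro h u v huv
    have h1 := congrFun h ⟨s(u, v), huv⟩
    rw [key] at h1
    have h2 : s((Quot.out s(u, v)).1, (Quot.out s(u, v)).2) = s(u, v) := Quot.out_eq s(u, v)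
    simp only [Pi.zero_apply] at h1
    rcases Sym2.eq_iff.1 h2 with ⟨ha, hb⟩ | ⟨ha, hb⟩
    · rw [ha, hb] at h1
      exact h1
    · rw [ha, hb] at h1
      rw [← h1]
      exact Finset.sum_congr rfl fun l _ => by ring
  · intro h
    funext e
    rw [key]
    exact h _ _ (out_adj e)

-- In the limit a monochromatic edge has direction `e_{c u}`, weighted by `y u - y v ≠ 0`, and a
-- bichromatic edge has direction `e_{c u} - e_{c v}`. Orthogonality of the relative velocity to
-- these directions gives the two conditions.
open Classical in
theorem scaledMatrix_zero_mulVec [Fintype V] (G : SimpleGraph V) (c : V → Fin d) {y : V → ℝ}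
    (hy : Function.Injective y) {m : V × Fin d → ℝ}
    (hm : (scaledMatrix G c y 0).mulVec m = 0) {u v : V} (huv : G.Adj u v) :
    (c u = c v → m (u, c u) = m (v, c u)) ∧
    (c u ≠ c v → m (u, c u) - m (u, c v) = m (v, c u) - m (v, c v)) := by
  have key : ∀ e : G.edgeSet, (scaledMatrix G c y 0).mulVec m e =
      ∑ l, (if c (Quot.out (e : Sym2 V)).1 = c (Quot.out (e : Sym2 V)).2 then
          (y (Quot.out (e : Sym2 V)).1 - y (Quot.out (e : Sym2 V)).2) *
            (Pi.single (c (Quot.out (e : Sym2 V)).1) 1 : Fin d → ℝ) l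
        else ((Pi.single (c (Quot.out (e : Sym2 V)).1) 1 : Fin d → ℝ) l -
          (Pi.single (c (Quot.out (e : Sym2 V)).2) 1 : Fin d → ℝ) l)) *
        (m ((Quot.out (e : Sym2 V)).1, l) - m ((Quot.out (e : Sym2 V)).2, l)) := by
    intro e
    rw [← sum_incidence_mul (out_adj e).ne]
    simp only [Matrix.mulVec, dotProduct, scaledMatrix]
    refine Finset.sum_congr rfl fun x _ => ?_
    by_cases h : c (Quot.out (e : Sym2 V)).1 = c (Quot.out (e : Sym2 V)).2
    · simp only [h, if_true]; ring
    · simp only [h, if_false, zero_mul, add_zero]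
  have h1 := congrFun hm ⟨s(u, v), huv⟩
  rw [key] at h1
  have h2 : s((Quot.out s(u, v)).1, (Quot.out s(u, v)).2) = s(u, v) := Quot.out_eq s(u, v)
  have hyne : y u - y v ≠ 0 := sub_ne_zero.2 fun h => huv.ne (hy h)
  have hyne' : y v - y u ≠ 0 := sub_ne_zero.2 fun h => huv.ne (hy h).symm
  rcases Sym2.eq_iff.1 h2 with ⟨ha, hb⟩ | ⟨ha, hb⟩
  · simp only [ha, hb, Pi.zero_apply] at h1
    refine ⟨fun hc => ?_, fun hc => ?_⟩
    · simp only [hc, if_true, mul_assoc, ← Finset.mul_sum] at h1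
      have := (mul_eq_zero.1 h1).resolve_left hyne
      simp [Pi.single_apply] at this
      rw [hc]
      linarith
    · simp [hc, Pi.single_apply, sub_mul, Finset.sum_sub_distrib] at h1
      linarith
  · simp only [ha, hb, Pi.zero_apply] at h1
    refine ⟨fun hc => ?_, fun hc => ?_⟩
    · simp only [hc, if_true, mul_assoc, ← Finset.mul_sum] at h1
      have := (mul_eq_zero.1 h1).resolve_left hyne'
      simp [Pi.single_apply] at this
      rw [hc]
      linarith
    · simp [Ne.symm hc, Pi.single_apply, sub_mul, Finset.sum_sub_distrib] at h1
      linarith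

/-- A function on the vertices that is constant along edges of a connected graph is constant. -/
theorem eq_of_connected {W β : Type*} {H : SimpleGraph W} (hH : H.Connected) (f : W → β)
    (hf : ∀ u v, H.Adj u v → f u = f v) (u v : W) : f u = f v := by
  obtain ⟨p⟩ := hH.preconnected u v
  induction p with
  | nil => rfl
  | cons h _ ih => exact (hf _ _ h).trans ih

/-- The indices of the basic infinitesimal isometries: translations and coordinate rotations. -/
abbrev IsometryIndex (d : ℕ) := {x : Fin d × Fin d // x.1 ≤ x.2}

theorem card_isometryIndex (d : ℕ) : Fintype.card (IsometryIndex d) = (d + 1).choose 2 := by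
  rw [← Fintype.card_congr (Sym2.sortEquiv (α := Fin d)), Sym2.card, Fintype.card_fin]

-- An element of the kernel is determined by its invariants on the connected pieces: inside a class
-- the coordinate of that class is constant, and on the union of two classes the difference of their
-- two coordinates is constant.
open Classical in
theorem finrank_ker_scaledMatrix_zero_le [Fintype V] {G : SimpleGraph V} {P : Fin d → Set V}
    (hP : IsStrongRigidPartition G d P) {c : V → Fin d} (hc : ∀ v i, v ∈ P i ↔ c v = i)
    {y : V → ℝ} (hy : Function.Injective y) :
    Module.finrank ℝ (LinearMap.ker (scaledMatrix G c y 0).mulVecLin) ≤ (d + 1).choose 2 := by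
  choose b hb using hP.nonempty
  have hb' : ∀ i, c (b i) = i := fun i => (hc _ _).1 (hb i)
  -- `Φ` reads each of these constants at a base vertex `b i`; diagonal indices stand for single
  -- classes and the others for pairs of classes.
  let Φ : (V × Fin d → ℝ) →ₗ[ℝ] (IsometryIndex d → ℝ) :=
    { toFun := fun m x => if x.1.1 = x.1.2 then m (b x.1.1, x.1.1)
        else m (b x.1.1, x.1.1) - m (b x.1.1, x.1.2)
      map_add' := by
        intro m m'; funext x; simp only [Pi.add_apply]; split_ifs <;> ring
      map_smul' := by
        intro r m; funext x; simp only [Pi.smul_apply, smul_eq_mul, RingHom.id_apply]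
        split_ifs <;> ring }
  have hinj : Function.Injective
      (Φ.domRestrict (LinearMap.ker (scaledMatrix G c y 0).mulVecLin)) := by
    rw [← LinearMap.ker_eq_bot, LinearMap.ker_eq_bot']
    rintro ⟨m, hm⟩ hΦ
    have hm : (scaledMatrix G c y 0).mulVec m = 0 := by simpa using hm
    have hΦ' : ∀ x : IsometryIndex d, (if x.1.1 = x.1.2 then m (b x.1.1, x.1.1)
        else m (b x.1.1, x.1.1) - m (b x.1.1, x.1.2)) = 0 := fun x => congrFun hΦ x
    have hdiag : ∀ v, m (v, c v) = 0 := by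
      intro v
      have h0 := hΦ' ⟨(c v, c v), le_rfl⟩
      simp only [if_true] at h0
      have := eq_of_connected (hP.connected (c v) (c v) le_rfl)
        (fun w => m (w.1, c v)) (by
          intro u w huw
          have huw' : (G.between (P (c v)) (P (c v))).Adj u.1 w.1 := huw
          rw [SimpleGraph.between_adj] at huw'
          have hu : c u.1 = c v := (hc _ _).1 (by tauto)
          have hw : c w.1 = c v := (hc _ _).1 (by tauto)
          have := (scaledMatrix_zero_mulVec G c hy hm huw'.1).1 (hu.trans hw.symm)
          rw [hu] at this
          exact this) ⟨v, Or.inl ((hc _ _).2 rfl)⟩ ⟨b (c v), Or.inl (hb _)⟩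
      simp only at this
      rw [this, h0]
    have hoff : ∀ i j, i < j → ∀ v, c v = i ∨ c v = j → m (v, i) = m (v, j) := by
      intro i j hij v hv
      have h0 := hΦ' ⟨(i, j), hij.le⟩
      simp only [hij.ne, if_false] at h0
      have := eq_of_connected (hP.connected i j hij.le)
        (fun w => m (w.1, i) - m (w.1, j)) (by
          intro u w huw
          have huw' : (G.between (P i) (P j)).Adj u.1 w.1 := huw
          rw [SimpleGraph.between_adj] at huw'
          simp only [hc] at huw'
          have h2 := (scaledMatrix_zero_mulVec G c hy hm huw'.1).2
          rcases huw'.2 with ⟨h3, h4⟩ | ⟨h3, h4⟩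
          · rw [h3, h4] at h2
            exact h2 hij.ne
          · rw [h3, h4] at h2
            have := h2 hij.ne'
            linarith) ⟨v, hv.imp (hc _ _).2 (hc _ _).2⟩ ⟨b i, Or.inl (hb _)⟩
      simp only at this
      linarith
    ext ⟨v, l⟩
    change m (v, l) = 0
    rcases lt_trichotomy (c v) l with h | h | h
    · rw [← hoff _ _ h v (Or.inl rfl), hdiag]
    · rw [← h, hdiag]
    · rw [hoff _ _ h v (Or.inr rfl), hdiag]
  calc _ ≤ Module.finrank ℝ (IsometryIndex d → ℝ) := LinearMap.finrank_le_finrank_of_injective hinj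
    _ = _ := by rw [Module.finrank_fintype_fun_eq_card, card_isometryIndex]

open Classical in
/-- The trivial infinitesimal motions of a framework whose placement is on the coordinate axes. -/
theorem le_finrank_ker_rigidityMatrix [Fintype V] (G : SimpleGraph V) {c : V → Fin d}
    (hc : Function.Surjective c) (hcard : d + 1 ≤ Fintype.card V) {a : V → ℝ}
    (ha : Function.Injective a) (ha0 : ∀ v, a v ≠ 0) :
    (d + 1).choose 2 ≤ Module.finrank ℝ (LinearMap.ker
      (rigidityMatrix G (fun v => (Pi.single (c v) (a v) : Fin d → ℝ))).mulVecLin) := by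
  set p : V → Fin d → ℝ := fun v => (Pi.single (c v) (a v) : Fin d → ℝ) with hp
  let A : (IsometryIndex d → ℝ) → Fin d → Fin d → ℝ := fun z l j =>
    if h : l < j then z ⟨(l, j), h.le⟩ else if h : j < l then - z ⟨(j, l), h.le⟩ else 0
  have hA : ∀ z l j, A z l j = - A z j l := by
    intro z l j
    simp only [A]
    rcases lt_trichotomy l j with h | h | h
    · simp [h, h.not_gt]
    · simp [h]
    · simp [h, h.not_gt]
  let Ψ : (IsometryIndex d → ℝ) →ₗ[ℝ] (V × Fin d → ℝ) :=
    { toFun := fun z x => z ⟨(x.2, x.2), le_rfl⟩ + ∑ j, A z x.2 j * p x.1 j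
      map_add' := by
        intro z z'
        funext x
        have : ∀ j, A (z + z') x.2 j = A z x.2 j + A z' x.2 j := by
          intro j; simp only [A, Pi.add_apply]; split_ifs <;> ring
        simp only [Pi.add_apply, this, add_mul, Finset.sum_add_distrib]
        ring
      map_smul' := by
        intro r z
        funext x
        have : ∀ j, A (r • z) x.2 j = r * A z x.2 j := by
          intro j; simp only [A, Pi.smul_apply, smul_eq_mul]; split_ifs <;> ring
        simp only [Pi.smul_apply, smul_eq_mul, this, RingHom.id_apply, mul_assoc,
          ← Finset.mul_sum]
        ring }
  have hker : ∀ z, Ψ z ∈ LinearMap.ker (rigidityMatrix G p).mulVecLin := by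
    intro z
    rw [LinearMap.mem_ker, Matrix.mulVecLin_apply, rigidityMatrix_mulVec_eq_zero_iff]
    intro u v _
    set q : Fin d → ℝ := fun l => p u l - p v l with hq
    have h1 : ∀ l, Ψ z (u, l) - Ψ z (v, l) = ∑ j, A z l j * q j := by
      intro l
      simp only [Ψ, LinearMap.coe_mk, AddHom.coe_mk, q, mul_sub, Finset.sum_sub_distrib]
      ring
    have h2 : ∑ l, q l * ∑ j, A z l j * q j = - ∑ l, q l * ∑ j, A z l j * q j := by
      simp only [Finset.mul_sum]
      conv_lhs => rw [Finset.sum_comm]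
      rw [← Finset.sum_neg_distrib]
      refine Finset.sum_congr rfl fun i _ => ?_
      rw [← Finset.sum_neg_distrib]
      refine Finset.sum_congr rfl fun j _ => ?_
      rw [hA z j i]; ring
    calc ∑ l, (p u l - p v l) * (Ψ z (u, l) - Ψ z (v, l)) = ∑ l, q l * ∑ j, A z l j * q j :=
          Finset.sum_congr rfl fun l _ => by rw [h1]
      _ = 0 := by linarith
  have hinj : Function.Injective (Ψ.codRestrict _ hker) := by
    rw [← LinearMap.ker_eq_bot, LinearMap.ker_eq_bot']
    intro z hz
    have hz' : ∀ v l, z ⟨(l, l), le_rfl⟩ + A z l (c v) * a v = 0 := by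
      intro v l
      have h := congrFun (congrArg Subtype.val hz) (v, l)
      change z ⟨(l, l), le_rfl⟩ + ∑ j, A z l j * p v j = 0 at h
      simpa [hp, Pi.single_apply] using h
    -- Two distinct points on the same axis separate the translation part from the rotation part;
    -- this is where `d + 1 ≤ |V|` enters.
    obtain ⟨u, v, huv, hcuv⟩ : ∃ u v, u ≠ v ∧ c u = c v := by
      apply Fintype.exists_ne_map_eq_of_card_lt c
      rw [Fintype.card_fin]; omega
    have hdiag : ∀ l, z ⟨(l, l), le_rfl⟩ = 0 := by
      intro l
      have h1 := hz' u l
      have h2 := hz' v l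
      rw [hcuv] at h1
      have h3 : A z l (c v) * (a u - a v) = 0 := by linarith
      have h4 : A z l (c v) = 0 :=
        (mul_eq_zero.1 h3).resolve_right (sub_ne_zero.2 fun h => huv (ha h))
      rw [h4] at h1
      linarith
    have hoff : ∀ l j, A z l j = 0 := by
      intro l j
      obtain ⟨v, rfl⟩ := hc j
      have := hz' v l
      rw [hdiag, zero_add] at this
      exact (mul_eq_zero.1 this).resolve_right (ha0 v)
    funext ⟨⟨i, j⟩, hij⟩
    change i ≤ j at hij
    rcases hij.eq_or_lt with h | h
    · subst h; exact hdiag i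
    · have := hoff i j
      simp only [A, h, dif_pos] at this
      exact this
  calc (d + 1).choose 2 = Module.finrank ℝ (IsometryIndex d → ℝ) := by
        rw [Module.finrank_fintype_fun_eq_card, card_isometryIndex]
    _ ≤ _ := LinearMap.finrank_le_finrank_of_injective hinj

theorem rank_add_finrank_ker {ι κ : Type*} [Fintype ι] [Fintype κ] (M : Matrix ι κ ℝ) :
    M.rank + Module.finrank ℝ (LinearMap.ker M.mulVecLin) = Fintype.card κ := by
  have := LinearMap.finrank_range_add_finrank_ker M.mulVecLin
  rwa [Module.finrank_fintype_fun_eq_card] at this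

/-- Lower semicontinuity of rank: the operators of rank at least a given number form an open set. It
carries the rank of the degenerate matrix at `t = 0` over to an actual framework. -/
theorem eventually_rank_le {ι κ : Type*} [Fintype ι] [Fintype κ] (M : ℝ → Matrix ι κ ℝ)
    (hM : ∀ i j, Continuous fun t => M t i j) :
    ∀ᶠ t in nhds 0, (M 0).rank ≤ (M t).rank := by
  classical
  have hcont : Continuous fun t => LinearMap.toContinuousLinearMap (M t).mulVecLin := by
    have h1 : Continuous M := continuous_pi fun i => continuous_pi fun j => hM i j
    have h2 : Continuous fun N : Matrix ι κ ℝ =>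
        LinearMap.toContinuousLinearMap (Matrix.toLin' N) := by
      let L : Matrix ι κ ℝ →ₗ[ℝ] ((κ → ℝ) →L[ℝ] (ι → ℝ)) :=
        (LinearMap.toContinuousLinearMap.toLinearMap).comp Matrix.toLin'.toLinearMap
      exact L.continuous_of_finiteDimensional
    exact h2.comp h1
  have hopen := (isOpen_setOfPred_nat_le_rank (𝕜 := ℝ) (E := κ → ℝ) (F := ι → ℝ)
    (M 0).rank).preimage hcont
  have hrank : ∀ t, LinearMap.rank (M t).mulVecLin = ((M t).rank : Cardinal) := by
    intro t
    rw [LinearMap.rank, Matrix.rank, Module.finrank_eq_rank]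
  refine Filter.mem_of_superset (hopen.mem_nhds (x := 0) ?_) ?_
  · exact (hrank 0).ge
  · intro t ht
    have ht' : ((M 0).rank : Cardinal) ≤ LinearMap.rank (M t).mulVecLin := ht
    rw [hrank] at ht'
    exact_mod_cast ht'

-- For `t ≠ 0` the scaled matrix is the rigidity matrix multiplied on the left by a diagonal matrix.
open Classical in
theorem rank_scaledMatrix_le [Fintype V] (G : SimpleGraph V) (c : V → Fin d) (y : V → ℝ) {t : ℝ}
    (ht : t ≠ 0) :
    (scaledMatrix G c y t).rank ≤
      (rigidityMatrix G (fun v => (Pi.single (c v) (1 + t * y v) : Fin d → ℝ))).rank := by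
  have : scaledMatrix G c y t = Matrix.diagonal (fun e : G.edgeSet =>
      if c (Quot.out (e : Sym2 V)).1 = c (Quot.out (e : Sym2 V)).2 then t⁻¹ else 1) *
      rigidityMatrix G (fun v => (Pi.single (c v) (1 + t * y v) : Fin d → ℝ)) := by
    ext e x
    rw [Matrix.diagonal_mul, rigidityMatrix_apply]
    simp only [scaledMatrix]
    by_cases h : c (Quot.out (e : Sym2 V)).1 = c (Quot.out (e : Sym2 V)).2
    · simp only [h, if_true]
      by_cases hx : x.2 = c (Quot.out (e : Sym2 V)).2
      · rw [hx]
        simp only [Pi.single_eq_same]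
        field_simp
        ring
      · simp [hx]
    · simp [h]
  rw [this]
  exact Matrix.rank_mul_le_right _ _

/-- A graph with a strong `d`-rigid partition is `d`-rigid. -/
theorem AdmitsStrongRigidPartition.isRigid [Fintype V] {G : SimpleGraph V}
    (h : AdmitsStrongRigidPartition G d) (hcard : d + 1 ≤ Fintype.card V) : IsRigid G d := by
  classical
  obtain ⟨P, hP⟩ := h
  have hex : ∀ v, ∃ i, v ∈ P i := fun v => by
    have : v ∈ ⋃ i, P i := by rw [hP.cover]; trivial
    simpa using this
  choose c hcP using hex
  have hc : ∀ v i, v ∈ P i ↔ c v = i := by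
    intro v i
    refine ⟨fun hv => ?_, fun hv => hv ▸ hcP v⟩
    by_contra hne
    exact Set.disjoint_left.1 (hP.disjoint _ _ hne) (hcP v) hv
  have hsurj : Function.Surjective c := fun i => by
    obtain ⟨v, hv⟩ := hP.nonempty i
    exact ⟨v, (hc _ _).1 hv⟩
  -- Distinct values separate points on a common axis; nonnegative values keep `1 + t * y v` nonzero
  -- for every `t > 0`.
  set y : V → ℝ := fun v => ((Fintype.equivFin V v : ℕ) : ℝ) with hydef
  have hy : Function.Injective y := by
    intro u v huv
    have : (Fintype.equivFin V u : ℕ) = Fintype.equivFin V v := by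
      have h : ((Fintype.equivFin V u : ℕ) : ℝ) = ((Fintype.equivFin V v : ℕ) : ℝ) := huv
      exact_mod_cast h
    exact (Fintype.equivFin V).injective (Fin.ext this)
  have hev := eventually_rank_le (scaledMatrix G c y) (by
    intro e x
    simp only [scaledMatrix]
    split_ifs
    all_goals simp only [Pi.single_apply]
    all_goals split_ifs
    all_goals fun_prop)
  obtain ⟨t, ht, ht0⟩ : ∃ t : ℝ, (scaledMatrix G c y 0).rank ≤ (scaledMatrix G c y t).rank ∧
      0 < t := by
    have h2 : ∀ᶠ t in nhdsWithin (0 : ℝ) (Set.Ioi 0), 0 < t := eventually_mem_nhdsWithin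
    exact ((hev.filter_mono nhdsWithin_le_nhds).and h2).exists
  set a : V → ℝ := fun v => 1 + t * y v with hadef
  have ha0 : ∀ v, a v ≠ 0 := fun v => by
    have : 0 ≤ y v := Nat.cast_nonneg _
    positivity
  have ha : Function.Injective a := by
    intro u v huv
    have : t * y u = t * y v := by simpa [hadef] using huv
    exact hy (mul_left_cancel₀ ht0.ne' this)
  have hpinj : Function.Injective (fun v => (Pi.single (c v) (a v) : Fin d → ℝ)) := by
    intro u v huv
    simp only at huv
    have h1 := congrFun huv (c u)
    rw [Pi.single_eq_same] at h1
    by_cases hcuv : c u = c v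
    · rw [hcuv, Pi.single_eq_same] at h1
      exact ha h1
    · rw [Pi.single_eq_of_ne hcuv] at h1
      exact absurd h1 (ha0 u)
  refine ⟨hcard, ⟨_, hpinj⟩, ?_⟩
  unfold InfinitesimallyRigid
  have e1 := rank_add_finrank_ker (scaledMatrix G c y 0)
  have e2 := rank_add_finrank_ker
    (rigidityMatrix G (fun v => (Pi.single (c v) (a v) : Fin d → ℝ)))
  have e3 := finrank_ker_scaledMatrix_zero_le hP hc hy
  have e4 := le_finrank_ker_rigidityMatrix G hsurj hcard ha ha0
  have e5 := rank_scaledMatrix_le G c y ht0.ne'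
  rw [Fintype.card_prod, Fintype.card_fin, mul_comm] at e1 e2
  change (rigidityMatrix G (fun v => (Pi.single (c v) (a v) : Fin d → ℝ))).rank + _ = _
  have e6 : (scaledMatrix G c y t).rank ≤
    (rigidityMatrix G (fun v => (Pi.single (c v) (a v) : Fin d → ℝ))).rank := e5
  omega

end Rigidity

open Finset

/-! ### The symmetric local lemma and a tail bound, by counting colourings -/

section LocalLemma

variable {V α ι : Type*} [Fintype V] [DecidableEq V] [Fintype α] [DecidableEq α]

/-- Events that depend on disjoint sets of coordinates are independent under the uniform
distribution on `V → α`. -/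
theorem card_inter_mul_card_of_dependsOn (N : Finset V) (A B : Finset (V → α))
    (hA : ∀ f g, (∀ v ∈ N, f v = g v) → f ∈ A → g ∈ A)
    (hB : ∀ f g, (∀ v, v ∉ N → f v = g v) → f ∈ B → g ∈ B) :
    #(A ∩ B) * Fintype.card (V → α) = #A * #B := by
  rw [← card_univ, ← card_product, ← card_product]
  -- The involution `σ` exchanges the coordinates outside `N` between the two colourings; it maps
  -- `(A ∩ B) × univ` onto `A × B`.
  let σ : (V → α) × (V → α) → (V → α) × (V → α) := fun z =>
    (fun v => if v ∈ N then z.1 v else z.2 v, fun v => if v ∈ N then z.2 v else z.1 v)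
  have hσ : ∀ z, σ (σ z) = z := by
    intro z
    refine Prod.ext (funext fun v => ?_) (funext fun v => ?_) <;>
      by_cases hv : v ∈ N <;> simp [σ, hv]
  refine card_bij' (fun z _ => σ z) (fun z _ => σ z) ?_ ?_ (fun z _ => hσ z) (fun z _ => hσ z)
  · intro z hz
    simp only [mem_product, mem_inter] at hz ⊢
    exact ⟨hA z.1 _ (fun v hv => by simp [σ, hv]) hz.1.1,
      hB z.1 _ (fun v hv => by simp [σ, hv]) hz.1.2⟩
  · intro z hz
    simp only [mem_product, mem_inter, mem_univ, and_true] at hz ⊢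
    exact ⟨hA z.1 _ (fun v hv => by simp [σ, hv]) hz.1,
      hB z.2 _ (fun v hv => by simp [σ, hv]) hz.2⟩

/-- The conditional probability estimate in the symmetric local lemma. -/
theorem card_filter_le_of_local [Fintype ι] [DecidableEq ι] (N : ι → Finset V)
    (A : ι → Finset (V → α))
    (hA : ∀ i f g, (∀ v ∈ N i, f v = g v) → f ∈ A i → g ∈ A i) {p : ℝ} {D : ℕ}
    (hp : ∀ i, (#(A i) : ℝ) ≤ p * Fintype.card (V → α))
    (hp0 : 0 ≤ p) (hD : ∀ i, #{j | ¬ Disjoint (N i) (N j)} ≤ D) (h : 4 * p * D ≤ 1)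
    (S : Finset ι) (i : ι) :
    (#{f | f ∈ A i ∧ ∀ j ∈ S, f ∉ A j} : ℝ) ≤ 2 * p * #{f | ∀ j ∈ S, f ∉ A j} := by
  induction hn : #S using Nat.strong_induction_on generalizing S i with
  | _ n ih =>
  rcases isEmpty_or_nonempty (V → α) with hem | hne
  · simp [Finset.eq_empty_of_isEmpty]
  have hcard : (0 : ℝ) < Fintype.card (V → α) := by exact_mod_cast Fintype.card_pos
  set S₁ := S.filter fun j => ¬ Disjoint (N i) (N j) with hS₁
  set S₂ := S.filter fun j => Disjoint (N i) (N j) with hS₂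
  set W : Finset ι → Finset (V → α) := fun T => univ.filter fun f => ∀ j ∈ T, f ∉ A j with hW
  have hind : (#(A i ∩ W S₂) : ℝ) ≤ p * #(W S₂) := by
    have h1 := card_inter_mul_card_of_dependsOn (N i) (A i) (W S₂) (hA i) (by
      intro f g hfg hf
      simp only [hW, mem_filter, mem_univ, true_and] at hf ⊢
      intro j hj hgj
      refine hf j hj (hA j g f (fun v hv => (hfg v ?_).symm) hgj)
      intro hvi
      exact Finset.disjoint_left.1 (mem_filter.1 hj).2 hvi hv)
    have h2 : (#(A i ∩ W S₂) : ℝ) * Fintype.card (V → α) = #(A i) * #(W S₂) := by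
      exact_mod_cast h1
    have h3 : (#(A i) : ℝ) * #(W S₂) ≤ p * Fintype.card (V → α) * #(W S₂) :=
      mul_le_mul_of_nonneg_right (hp i) (Nat.cast_nonneg _)
    refine le_of_mul_le_mul_right ?_ hcard
    rw [h2]
    linarith
  have hsub : (#{f | f ∈ A i ∧ ∀ j ∈ S, f ∉ A j} : ℝ) ≤ #(A i ∩ W S₂) := by
    refine Nat.cast_le.2 (card_le_card fun f hf => ?_)
    simp only [hW, mem_filter, mem_univ, true_and, mem_inter] at hf ⊢
    exact ⟨hf.1, fun j hj => hf.2 j (mem_filter.1 hj).1⟩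
  -- Given that the events in `S₂` are avoided, each of the at most `D` events in `S₁` has
  -- conditional probability at most `2 * p` by induction. Together they remove at most `2 * p * D ≤
  -- 1 / 2` of `W S₂`.
  have hhalf : (#(W S₂) : ℝ) ≤ 2 * #(W S) := by
    have hcov : W S₂ ⊆ W S ∪ S₁.biUnion fun j => univ.filter fun f =>
        f ∈ A j ∧ ∀ l ∈ S₂, f ∉ A l := by
      intro f hf
      by_cases hfS : f ∈ W S
      · exact mem_union_left _ hfS
      · refine mem_union_right _ ?_
        simp only [hW, mem_filter, mem_univ, true_and, not_forall, not_not] at hfS hf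
        obtain ⟨j, hj, hfj⟩ := hfS
        refine mem_biUnion.2 ⟨j, mem_filter.2 ⟨hj, fun hd => hf j (mem_filter.2 ⟨hj, hd⟩) hfj⟩, ?_⟩
        simp only [mem_filter, mem_univ, true_and]
        exact ⟨hfj, hf⟩
    have h1 : (#(W S₂) : ℝ) ≤ #(W S) + ∑ j ∈ S₁, (#{f | f ∈ A j ∧ ∀ l ∈ S₂, f ∉ A l} : ℝ) := by
      have := (card_le_card hcov).trans ((card_union_le _ _).trans
        (Nat.add_le_add_left card_biUnion_le _))
      exact_mod_cast this
    have h2 : ∑ j ∈ S₁, (#{f | f ∈ A j ∧ ∀ l ∈ S₂, f ∉ A l} : ℝ) ≤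
        #S₁ * (2 * p * #(W S₂)) := by
      rw [← nsmul_eq_mul]
      refine sum_le_card_nsmul _ _ _ fun j hj => ?_
      refine ih #S₂ ?_ S₂ j rfl
      rw [← hn]
      refine card_lt_card (Finset.ssubset_iff_subset_ne.2 ⟨filter_subset _ _, fun he => ?_⟩)
      have hj' := mem_filter.1 hj
      rw [← he] at hj'
      exact hj'.2 (mem_filter.1 hj'.1).2
    have h3 : (#S₁ : ℝ) ≤ D := by
      refine Nat.cast_le.2 ((card_le_card ?_).trans (hD i))
      intro j hj
      simpa using (mem_filter.1 hj).2
    have h4 : (#S₁ : ℝ) * (2 * p * #(W S₂)) ≤ 1 / 2 * #(W S₂) := by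
      calc (#S₁ : ℝ) * (2 * p * #(W S₂)) ≤ D * (2 * p * #(W S₂)) := by gcongr
        _ = (4 * p * D) / 2 * #(W S₂) := by ring
        _ ≤ 1 / 2 * #(W S₂) := by gcongr
    linarith
  calc (#{f | f ∈ A i ∧ ∀ j ∈ S, f ∉ A j} : ℝ) ≤ p * #(W S₂) := hsub.trans hind
    _ ≤ p * (2 * #(W S)) := by gcongr
    _ = _ := by rw [hW]; ring

/-- The symmetric local lemma for uniformly random colourings. -/
theorem exists_forall_notMem_of_local [Fintype ι] [DecidableEq ι] [Nonempty α]
    (N : ι → Finset V) (A : ι → Finset (V → α))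
    (hA : ∀ i f g, (∀ v ∈ N i, f v = g v) → f ∈ A i → g ∈ A i) {p : ℝ} {D : ℕ}
    (hp : ∀ i, (#(A i) : ℝ) ≤ p * Fintype.card (V → α))
    (hp0 : 0 ≤ p) (hp1 : 2 * p < 1) (hD : ∀ i, #{j | ¬ Disjoint (N i) (N j)} ≤ D)
    (h : 4 * p * D ≤ 1) : ∃ f : V → α, ∀ i, f ∉ A i := by
  have key : ∀ S : Finset ι, 0 < (#{f | ∀ j ∈ S, f ∉ A j} : ℝ) := by
    intro S
    induction S using Finset.induction_on with
    | empty =>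
      have : 0 < Fintype.card α := Fintype.card_pos
      simp only [notMem_empty, IsEmpty.forall_iff, implies_true, filter_true, card_univ,
        Fintype.card_fun]
      positivity
    | insert i S hi ih =>
      have h1 := card_filter_le_of_local N A hA hp hp0 hD h S i
      have h2 : (#{f | ∀ j ∈ S, f ∉ A j} : ℝ) ≤ #{f | f ∈ A i ∧ ∀ j ∈ S, f ∉ A j} +
          #{f | ∀ j ∈ insert i S, f ∉ A j} := by
        rw [← Nat.cast_add]
        refine Nat.cast_le.2 (le_trans (card_le_card fun f hf => ?_) (card_union_le _ _))
        simp only [mem_filter, mem_univ, true_and, mem_union, forall_mem_insert] at hf ⊢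
        tauto
      nlinarith
  have := key univ
  rw [Nat.cast_pos, card_pos] at this
  obtain ⟨f, hf⟩ := this
  exact ⟨f, fun i => (mem_filter.1 hf).2 i (mem_univ i)⟩

/-- A lower tail bound for the number of vertices of a given colour in a random colouring. -/
theorem card_filter_card_lt_le [Nonempty α] (N : Finset V) (c : α) (δ : ℕ) :
    (#{f : V → α | #{u ∈ N | f u = c} < δ} : ℝ) ≤
      2 ^ δ * (1 - 1 / (2 * Fintype.card α)) ^ #N * Fintype.card (V → α) := by
  -- Markov's inequality for `2 ^ (-X)`, where `X` is the number of vertices of `N` coloured `c`;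
  -- its expectation factorises over the vertices.
  set F : V → α → ℝ := fun u a => if u ∈ N ∧ a = c then 1 / 2 else 1 with hF
  have hd : (0 : ℝ) < Fintype.card α := by exact_mod_cast Fintype.card_pos
  have hsum : ∀ u, ∑ a, F u a = Fintype.card α *
      (if u ∈ N then 1 - 1 / (2 * Fintype.card α : ℝ) else 1) := by
    intro u
    by_cases hu : u ∈ N
    · have : ∀ a, F u a = 1 - (if a = c then 1 / 2 else 0) := by
        intro a; simp only [hF, hu, true_and]; split_ifs <;> norm_num
      simp only [this, sum_sub_distrib, sum_ite_eq', mem_univ, if_true, hu, sum_const, card_univ,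
        nsmul_eq_mul, mul_one]
      field_simp
    · simp [hF, hu]
  have htot : ∑ f : V → α, ∏ u, F u (f u) =
      (1 - 1 / (2 * Fintype.card α : ℝ)) ^ #N * Fintype.card (V → α) := by
    have h1 := Finset.prod_univ_sum (fun _ : V => (univ : Finset α)) F
    rw [Fintype.piFinset_univ] at h1
    rw [← h1]
    simp only [hsum, prod_mul_distrib, prod_const, card_univ, prod_ite, Fintype.card_fun,
      Nat.cast_pow, one_pow, mul_one]
    rw [mul_comm]
    simp
  have hprod : ∀ f : V → α, ∏ u, F u (f u) = (1 / 2) ^ #{u ∈ N | f u = c} := by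
    intro f
    simp only [hF, prod_ite, prod_const, one_pow, mul_one]
    congr 2
    ext u; simp
  have hle : (1 / 2 : ℝ) ^ δ * #{f : V → α | #{u ∈ N | f u = c} < δ} ≤
      ∑ f : V → α, ∏ u, F u (f u) := by
    calc (1 / 2 : ℝ) ^ δ * #{f : V → α | #{u ∈ N | f u = c} < δ}
        = ∑ f : V → α with #{u ∈ N | f u = c} < δ, (1 / 2 : ℝ) ^ δ := by
          rw [sum_const, nsmul_eq_mul, mul_comm]
      _ ≤ ∑ f : V → α with #{u ∈ N | f u = c} < δ, ∏ u, F u (f u) := by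
          refine sum_le_sum fun f hf => ?_
          rw [hprod]
          exact pow_le_pow_of_le_one (by norm_num) (by norm_num) (mem_filter.1 hf).2.le
      _ ≤ _ := by
          refine sum_le_sum_of_subset_of_nonneg (subset_univ _) fun f _ _ => ?_
          rw [hprod]; positivity
  rw [htot] at hle
  calc (#{f : V → α | #{u ∈ N | f u = c} < δ} : ℝ)
      = 2 ^ δ * ((1 / 2 : ℝ) ^ δ * #{f : V → α | #{u ∈ N | f u = c} < δ}) := by
        rw [← mul_assoc, ← mul_pow]; norm_num
    _ ≤ 2 ^ δ * ((1 - 1 / (2 * Fintype.card α : ℝ)) ^ #N * Fintype.card (V → α)) := by gcongr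
    _ = _ := by ring

end LocalLemma

/-! ### Sparse and joined graphs have strong rigid partitions -/

section Pseudorandom

open scoped Classical

variable {V : Type*} [Fintype V]

/-- The neighbours of a vertex, as a finset. -/
noncomputable def nbrs (G : SimpleGraph V) (v : V) : Finset V := {u | G.Adj v u}

@[simp]
theorem mem_nbrs {G : SimpleGraph V} {u v : V} : u ∈ nbrs G v ↔ G.Adj v u := by
  simp [nbrs]

/-- The number of pairs in `X × Y` that are adjacent in `G`. -/
noncomputable def adjPairs {W : Type*} (G : SimpleGraph W) (X Y : Finset W) : ℕ :=
  #{z ∈ X ×ˢ Y | G.Adj z.1 z.2}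

theorem adjPairs_eq_sum (G : SimpleGraph V) (X Y : Finset V) :
    adjPairs G X Y = ∑ x ∈ X, #(nbrs G x ∩ Y) := by
  rw [adjPairs, card_filter, sum_product]
  refine sum_congr rfl fun x _ => ?_
  rw [← card_filter]
  congr 1
  ext y
  simp [and_comm]

theorem adjPairs_comm {W : Type*} (G : SimpleGraph W) (X Y : Finset W) :
    adjPairs G X Y = adjPairs G Y X := by
  refine card_bij' (fun z _ => z.swap) (fun z _ => z.swap) ?_ ?_ (by simp) (by simp)
  all_goals
    rintro ⟨x, y⟩ h
    simp only [mem_filter, mem_product, Prod.fst_swap, Prod.snd_swap] at h ⊢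
    exact ⟨h.1.symm, h.2.symm⟩

/-- All nonempty sets of at most `2 w` vertices span fewer than `δ / 2` edges per vertex. -/
def LocallySparse (G : SimpleGraph V) (δ w : ℕ) : Prop :=
  ∀ S : Finset V, S.Nonempty → #S ≤ 2 * w → adjPairs G S S < δ * #S

/-- Between any two disjoint sets of `w` vertices there is an edge. -/
def Joined (G : SimpleGraph V) (w : ℕ) : Prop :=
  ∀ X Y : Finset V, #X = w → #Y = w → Disjoint X Y → adjPairs G X Y ≠ 0

/-- There is a vertex colouring such that every vertex sees every colour at least `δ` times. -/
theorem exists_balanced_colouring {G : SimpleGraph V} {d k δ : ℕ} (hd : 0 < d) (hk0 : 0 < k)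
    (hreg : ∀ v, #(nbrs G v) = k)
    (h : 4 * (d * (2 ^ δ * (1 - 1 / (2 * d : ℝ)) ^ k)) * (k ^ 2 : ℕ) ≤ 1) :
    ∃ f : V → Fin d, ∀ v c, δ ≤ #{u ∈ nbrs G v | f u = c} := by
  have : Nonempty (Fin d) := ⟨⟨0, hd⟩⟩
  have hd1 : (1 : ℝ) ≤ d := by exact_mod_cast hd
  have hbase : (0 : ℝ) ≤ 1 - 1 / (2 * d) := by
    have : 1 / (2 * d : ℝ) ≤ 1 := by
      rw [div_le_one (by positivity)]; linarith
    linarith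
  set p : ℝ := d * (2 ^ δ * (1 - 1 / (2 * d : ℝ)) ^ k) with hp
  have hp0 : 0 ≤ p := by positivity
  have hk1 : (1 : ℝ) ≤ (k ^ 2 : ℕ) := by exact_mod_cast Nat.one_le_pow _ _ hk0
  obtain ⟨f, hf⟩ := exists_forall_notMem_of_local (V := V) (α := Fin d) (nbrs G)
    (fun v => {f | ∃ c, #{u ∈ nbrs G v | f u = c} < δ}) (p := p) (D := k ^ 2)
    (by
      intro v f g hfg hf
      simp only [mem_filter, mem_univ, true_and] at hf ⊢
      obtain ⟨c, hc⟩ := hf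
      refine ⟨c, ?_⟩
      convert hc using 2
      exact filter_congr fun u hu => by rw [hfg u hu])
    (by
      intro v
      have h1 : ({f | ∃ c, #{u ∈ nbrs G v | f u = c} < δ} : Finset (V → Fin d)) ⊆
          univ.biUnion fun c : Fin d => {f | #{u ∈ nbrs G v | f u = c} < δ} := by
        intro f hf
        simpa using hf
      calc (#{f : V → Fin d | ∃ c, #{u ∈ nbrs G v | f u = c} < δ} : ℝ)
          ≤ ∑ c : Fin d, (#{f : V → Fin d | #{u ∈ nbrs G v | f u = c} < δ} : ℝ) := by
            exact_mod_cast (card_le_card h1).trans card_biUnion_le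
        _ ≤ ∑ c : Fin d, 2 ^ δ * (1 - 1 / (2 * d : ℝ)) ^ k * Fintype.card (V → Fin d) := by
            refine sum_le_sum fun c _ => ?_
            have := card_filter_card_lt_le (nbrs G v) c δ
            rw [hreg, Fintype.card_fin] at this
            convert this using 2
        _ = p * Fintype.card (V → Fin d) := by
            rw [sum_const, card_univ, Fintype.card_fin, nsmul_eq_mul, hp]; ring)
    hp0
    (by nlinarith)
    (by
      intro v
      -- The bad event at `v` depends only on the colours of its neighbours, so it interacts only
      -- with vertices reached by a walk of length two, at most `k ^ 2` of them.
      have h1 : ({u | ¬ Disjoint (nbrs G v) (nbrs G u)} : Finset V) ⊆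
          (nbrs G v).biUnion fun x => nbrs G x := by
        intro u hu
        simp only [mem_filter, mem_univ, true_and, Finset.not_disjoint_iff] at hu
        obtain ⟨x, hx1, hx2⟩ := hu
        refine mem_biUnion.2 ⟨x, hx1, ?_⟩
        rw [mem_nbrs] at hx2 ⊢
        exact hx2.symm
      refine (card_le_card h1).trans (card_biUnion_le.trans ?_)
      simp [hreg, sq])
    h
  refine ⟨f, fun v c => ?_⟩
  have := hf v
  simp only [mem_filter, mem_univ, true_and, not_exists, not_lt] at this
  exact this c

/-- In a locally sparse graph, two sets with large mutual degrees cannot be small. -/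
theorem LocallySparse.le_card {G : SimpleGraph V} {δ w : ℕ} (hG : LocallySparse G δ w)
    {A B : Finset V} (hB : B.Nonempty) (hδ : 0 < δ) (hAB : A = B ∨ Disjoint A B)
    (hle : #A ≤ #B) (h : ∀ b ∈ B, δ ≤ #(nbrs G b ∩ A)) : w ≤ #A := by
  by_contra! hlt
  obtain ⟨b, hb⟩ := hB
  have hA : A.Nonempty := by
    have h1 : 0 < #(nbrs G b ∩ A) := hδ.trans_le (h b hb)
    obtain ⟨a, ha⟩ := card_pos.1 h1
    exact ⟨a, (mem_inter.1 ha).2⟩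
  rcases hAB with rfl | hdis
  · have h1 := hG A hA (by omega)
    rw [adjPairs_eq_sum] at h1
    have h2 := card_nsmul_le_sum A (fun x => #(nbrs G x ∩ A)) δ h
    rw [smul_eq_mul, mul_comm] at h2
    omega
  -- Shrinking `B` to the size of `A` makes `A ∪ B₀` small and balanced: counted in both orders, its
  -- adjacent pairs number at least `2 * δ * #A = δ * #(A ∪ B₀)`, against sparsity.
  · obtain ⟨B₀, hB₀, hcard⟩ := exists_subset_card_eq hle
    have hd0 : Disjoint A B₀ := hdis.mono_right hB₀
    have h1 := hG (A ∪ B₀) (hA.mono subset_union_left) (by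
      rw [card_union_of_disjoint hd0]; omega)
    have h2 := card_nsmul_le_sum B₀ (fun x => #(nbrs G x ∩ A)) δ fun b hb => h b (hB₀ hb)
    rw [← adjPairs_eq_sum, smul_eq_mul, hcard] at h2
    have h3 : adjPairs G A B₀ + adjPairs G B₀ A ≤ adjPairs G (A ∪ B₀) (A ∪ B₀) := by
      unfold adjPairs
      rw [← card_union_of_disjoint]
      · refine card_le_card fun z hz => ?_
        simp only [mem_union, mem_filter, mem_product] at hz ⊢
        tauto
      · rw [Finset.disjoint_left]
        intro z hz hz'
        simp only [mem_filter, mem_product] at hz hz'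
        exact Finset.disjoint_left.1 hd0 hz.1.1 hz'.1.1
    rw [adjPairs_comm G A B₀] at h3
    rw [card_union_of_disjoint hd0, hcard] at h1
    nlinarith

theorem LocallySparse.le_card_and_le_card {G : SimpleGraph V} {δ w : ℕ}
    (hG : LocallySparse G δ w) {A B : Finset V} (hne : (A ∪ B).Nonempty) (hδ : 0 < δ)
    (hAB : A = B ∨ Disjoint A B) (hA : ∀ a ∈ A, δ ≤ #(nbrs G a ∩ B))
    (hB : ∀ b ∈ B, δ ≤ #(nbrs G b ∩ A)) : w ≤ #A ∧ w ≤ #B := by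
  rcases le_total #A #B with h | h
  · have hBne : B.Nonempty := by
      rw [← card_pos]
      have := card_union_le A B
      have := card_pos.2 hne
      omega
    have := hG.le_card hBne hδ hAB h hB
    omega
  · have hAne : A.Nonempty := by
      rw [← card_pos]
      have := card_union_le A B
      have := card_pos.2 hne
      omega
    have := hG.le_card hAne hδ (hAB.imp Eq.symm fun h => h.symm) h hA
    omega

theorem connected_of_forall_cut {W : Type*} [Nonempty W] {H : SimpleGraph W}
    (h : ∀ S : Set W, S.Nonempty → Sᶜ.Nonempty → ∃ x ∈ S, ∃ y ∉ S, H.Adj x y) :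
    H.Connected := by
  refine (SimpleGraph.connected_iff _).2 ⟨fun u v => ?_, inferInstance⟩
  by_contra huv
  obtain ⟨x, hx, y, hy, hxy⟩ := h {x | H.Reachable u x} ⟨u, SimpleGraph.Reachable.refl u⟩ ⟨v, huv⟩
  exact hy (hx.trans hxy.reachable)

/-- A locally sparse and joined graph with a balanced colouring has a strong rigid partition. -/
theorem strongRigidPartition_of_colouring [Nonempty V] {G : SimpleGraph V} {d δ w : ℕ}
    (hδ : 0 < δ) (hsparse : LocallySparse G δ w) (hjoin : Joined G w) {f : V → Fin d}
    (hf : ∀ v c, δ ≤ #{u ∈ nbrs G v | f u = c}) : AdmitsStrongRigidPartition G d := by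
  have hne : ∀ i, ∃ v, f v = i := by
    intro i
    obtain ⟨v₀⟩ := ‹Nonempty V›
    obtain ⟨u, hu⟩ := card_pos.1 (hδ.trans_le (hf v₀ i))
    exact ⟨u, (mem_filter.1 hu).2⟩
  refine ⟨fun i => {v | f v = i}, hne, ?_, ?_, ?_⟩
  · intro i j hij
    rw [Set.disjoint_left]
    intro v hv hv'
    exact hij (hv.symm.trans hv')
  · ext v; simp
  · intro i j _
    obtain ⟨v₁, hv₁⟩ := hne i
    have : Nonempty (({v | f v = i} ∪ {v | f v = j} : Set V)) := ⟨⟨v₁, Or.inl hv₁⟩⟩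
    refine connected_of_forall_cut fun S hS hSc => ?_
    by_contra! hno
    have hadj : ∀ x y, x ∈ S → y ∉ S → ¬ (G.between {v | f v = i} {v | f v = j}).Adj x.1 y.1 :=
      fun x y hx hy hxy => hno x hx y hy hxy
    let T : Set V := Subtype.val '' S
    have hT : ∀ x (hx : f x = i ∨ f x = j), x ∈ T ↔
        (⟨x, hx⟩ : ({v | f v = i} ∪ {v | f v = j} : Set V)) ∈ S := by
      intro x hx
      constructor
      · rintro ⟨z, hz, rfl⟩; exact hz
      · intro h; exact ⟨_, h, rfl⟩
    have hcross : ∀ x y, x ∈ T → y ∉ T → (f x = i ∧ f y = j ∨ f x = j ∧ f y = i) →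
        ¬ G.Adj x y := by
      intro x y hx hy hxy hG
      have hxm : f x = i ∨ f x = j := by tauto
      have hym : f y = i ∨ f y = j := by tauto
      refine hadj ⟨x, hxm⟩ ⟨y, hym⟩ ((hT x hxm).1 hx) (fun h => hy ((hT y hym).2 h)) ?_
      rw [SimpleGraph.between_adj]
      exact ⟨hG, hxy⟩
    -- No relevant edge leaves `R`, so all the neighbours guaranteed by the colouring stay in `R`.
    -- This is used for both sides of the cut.
    have main : ∀ R : Set V, (∀ x y, x ∈ R → y ∉ R → (f x = i ∧ f y = j ∨ f x = j ∧ f y = i) →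
        ¬ G.Adj x y) → (∃ x ∈ R, f x = i ∨ f x = j) →
        w ≤ #{x | x ∈ R ∧ f x = i} ∧ w ≤ #{x | x ∈ R ∧ f x = j} := by
      intro R hR hRne
      refine hsparse.le_card_and_le_card ?_ hδ ?_ ?_ ?_
      · obtain ⟨x, hx, hx'⟩ := hRne
        refine ⟨x, ?_⟩
        simp only [mem_union, mem_filter, mem_univ, true_and]
        tauto
      · rcases eq_or_ne i j with rfl | hij
        · exact Or.inl rfl
        · refine Or.inr (Finset.disjoint_left.2 fun x hx hx' => hij ?_)
          simp only [mem_filter, mem_univ, true_and] at hx hx'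
          exact hx.2.symm.trans hx'.2
      · intro a ha
        simp only [mem_filter, mem_univ, true_and] at ha
        refine (hf a j).trans (card_le_card fun u hu => ?_)
        simp only [mem_filter, mem_nbrs, mem_inter, mem_univ, true_and] at hu ⊢
        exact ⟨hu.1, by_contra fun h => hR a u ha.1 h
          (Or.inl ⟨ha.2, hu.2⟩) hu.1, hu.2⟩
      · intro a ha
        simp only [mem_filter, mem_univ, true_and] at ha
        refine (hf a i).trans (card_le_card fun u hu => ?_)
        simp only [mem_filter, mem_nbrs, mem_inter, mem_univ, true_and] at hu ⊢
        exact ⟨hu.1, by_contra fun h => hR a u ha.1 h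
          (Or.inr ⟨ha.2, hu.2⟩) hu.1, hu.2⟩
    have hA := (main T hcross (by
      obtain ⟨x, hx⟩ := hS
      exact ⟨x.1, ⟨x, hx, rfl⟩, x.2⟩)).1
    have hB := (main Tᶜ (fun x y hx hy hxy hG =>
      hcross y x (not_not.1 hy) hx (by tauto) hG.symm) (by
      obtain ⟨x, hx⟩ := hSc
      exact ⟨x.1, fun h => hx ((hT x.1 x.2).1 h), x.2⟩)).2
    obtain ⟨X, hXsub, hXcard⟩ := exists_subset_card_eq hA
    obtain ⟨Y, hYsub, hYcard⟩ := exists_subset_card_eq hB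
    have hX : ∀ x ∈ X, x ∈ T ∧ f x = i := fun x hx => by simpa using hXsub hx
    have hY : ∀ x ∈ Y, x ∉ T ∧ f x = j := fun x hx => by simpa using hYsub hx
    refine hjoin X Y hXcard hYcard (Finset.disjoint_left.2 fun x hx hx' =>
      (hY x hx').1 (hX x hx).1) ?_
    rw [adjPairs, card_eq_zero, filter_eq_empty_iff]
    rintro ⟨x, y⟩ hxy
    rw [mem_product] at hxy
    exact hcross x y (hX x hxy.1).1 (hY y hxy.2).1 (Or.inl ⟨(hX x hxy.1).2, (hY y hxy.2).2⟩)

end Pseudorandom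

/-! ### Switchings between regular graphs -/

section Switching

open scoped Classical

variable {V : Type*}

/-- The graph with edges `xa`, `yb`, `xy`, `ab`. -/
def square (x a y b : V) : SimpleGraph V :=
  SimpleGraph.fromEdgeSet {s(x, a), s(y, b), s(x, y), s(a, b)}

/-- The edges `xa` and `yb` of `G` can be replaced by `xy` and `ab`. -/
def Switchable (G : SimpleGraph V) (x a y b : V) : Prop :=
  G.Adj x a ∧ G.Adj y b ∧ ¬ G.Adj x y ∧ ¬ G.Adj a b ∧ x ≠ y ∧ a ≠ b

/-- Writing the move as a symmetric difference with a graph that depends only on the four vertices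
makes it invertible once these are known, which is what the double counting uses. -/
theorem Switchable.adj_iff {G : SimpleGraph V} {x a y b : V} (h : Switchable G x a y b)
    (p q : V) : (symmDiff G (square x a y b)).Adj p q ↔
      (G.Adj p q ∧ s(p, q) ≠ s(x, a) ∧ s(p, q) ≠ s(y, b)) ∨ s(p, q) = s(x, y) ∨
        s(p, q) = s(a, b) := by
  obtain ⟨h1, h2, h3, h4, h5, h6⟩ := h
  have hxy : s(p, q) = s(x, y) → ¬ G.Adj p q ∧ p ≠ q := by
    intro h
    rcases Sym2.eq_iff.1 h with ⟨rfl, rfl⟩ | ⟨rfl, rfl⟩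
    · exact ⟨h3, h5⟩
    · exact ⟨fun h => h3 h.symm, h5.symm⟩
  have hab : s(p, q) = s(a, b) → ¬ G.Adj p q ∧ p ≠ q := by
    intro h
    rcases Sym2.eq_iff.1 h with ⟨rfl, rfl⟩ | ⟨rfl, rfl⟩
    · exact ⟨h4, h6⟩
    · exact ⟨fun h => h4 h.symm, h6.symm⟩
  have hxa : s(p, q) = s(x, a) → G.Adj p q := by
    intro h
    rcases Sym2.eq_iff.1 h with ⟨rfl, rfl⟩ | ⟨rfl, rfl⟩
    · exact h1
    · exact h1.symm
  have hyb : s(p, q) = s(y, b) → G.Adj p q := by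
    intro h
    rcases Sym2.eq_iff.1 h with ⟨rfl, rfl⟩ | ⟨rfl, rfl⟩
    · exact h2
    · exact h2.symm
  have hne : G.Adj p q → p ≠ q := fun h => h.ne
  simp only [symmDiff, square, SimpleGraph.sup_adj, SimpleGraph.sdiff_adj,
    SimpleGraph.fromEdgeSet_adj, Set.mem_insert_iff, Set.mem_singleton_iff]
  tauto

variable [Fintype V]

/-- Each of the four vertices trades one neighbour for a new one, and all other neighbourhoods are
unchanged. -/
theorem Switchable.card_nbrs {G : SimpleGraph V} {x a y b : V} (h : Switchable G x a y b)
    (v : V) : #(nbrs (symmDiff G (square x a y b)) v) = #(nbrs G v) := by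
  have hadj := h.adj_iff
  obtain ⟨h1, h2, h3, h4, h5, h6⟩ := h
  have hxa := h1.ne
  have hyb := h2.ne
  have hxb : x ≠ b := by rintro rfl; exact h3 h2.symm
  have hay : a ≠ y := by rintro rfl; exact h3 h1
  have swap : ∀ s t : V, s ∈ nbrs G v → t ∉ nbrs G v →
      nbrs (symmDiff G (square x a y b)) v = insert t ((nbrs G v).erase s) →
      #(nbrs (symmDiff G (square x a y b)) v) = #(nbrs G v) := by
    intro s t hs ht he
    rw [he, card_insert_of_notMem (fun h => ht (mem_of_mem_erase h)), card_erase_of_mem hs]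
    have := card_pos.2 ⟨s, hs⟩
    omega
  have hext : ∀ u, u ∈ nbrs (symmDiff G (square x a y b)) v ↔
      (G.Adj v u ∧ s(v, u) ≠ s(x, a) ∧ s(v, u) ≠ s(y, b)) ∨ s(v, u) = s(x, y) ∨
        s(v, u) = s(a, b) := fun u => by rw [mem_nbrs, hadj]
  by_cases hvx : v = x
  · subst hvx
    refine swap a y (by simpa using h1) (by simpa using h3) ?_
    ext u
    rw [hext]
    simp only [mem_insert, mem_erase, mem_nbrs, ne_eq, Sym2.eq_iff]
    grind
  by_cases hva : v = a
  · subst hva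
    refine swap x b (by simpa using h1.symm) (by simpa using h4) ?_
    ext u
    rw [hext]
    simp only [mem_insert, mem_erase, mem_nbrs, ne_eq, Sym2.eq_iff]
    grind
  by_cases hvy : v = y
  · subst hvy
    refine swap b x (by simpa using h2) (by simpa using fun h : G.Adj v x => h3 h.symm) ?_
    ext u
    rw [hext]
    simp only [mem_insert, mem_erase, mem_nbrs, ne_eq, Sym2.eq_iff]
    grind
  by_cases hvb : v = b
  · subst hvb
    refine swap y a (by simpa using h2.symm) (by simpa using fun h : G.Adj v a => h4 h.symm) ?_
    ext u
    rw [hext]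
    simp only [mem_insert, mem_erase, mem_nbrs, ne_eq, Sym2.eq_iff]
    grind
  · congr 1
    ext u
    rw [hext]
    simp only [mem_nbrs, ne_eq, Sym2.eq_iff]
    grind

/-- The `k`-regular graphs on `V`, as a finset. -/
noncomputable def regulars (V : Type*) [Fintype V] (k : ℕ) : Finset (SimpleGraph V) :=
  {G | ∀ v, #(nbrs G v) = k}

theorem mem_regulars {G : SimpleGraph V} {k : ℕ} :
    G ∈ regulars V k ↔ ∀ v, #(nbrs G v) = k := by
  simp [regulars]

theorem Switchable.mem_regulars {G : SimpleGraph V} {x a y b : V} (h : Switchable G x a y b)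
    {k : ℕ} (hG : G ∈ regulars V k) : symmDiff G (square x a y b) ∈ regulars V k := by
  rw [RigidPartition.mem_regulars] at hG ⊢
  intro v
  rw [h.card_nbrs, hG]

/-- Double counting of the moves `G ↦ G ∆ sq z`. -/
theorem card_mul_le_of_switching {W β : Type*} (A B : Finset (SimpleGraph W))
    (sq : β → SimpleGraph W) (D D' : SimpleGraph W → Finset β) {p q : ℕ}
    (hp : ∀ G ∈ A, p ≤ #(D G))
    (hD : ∀ G ∈ A, ∀ z ∈ D G, symmDiff G (sq z) ∈ B ∧ z ∈ D' (symmDiff G (sq z)))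
    (hq : ∀ G ∈ B, #(D' G) ≤ q) : #A * p ≤ #B * q := by
  calc #A * p ≤ ∑ G ∈ A, #(D G) := by
        rw [← smul_eq_mul]; exact card_nsmul_le_sum _ _ _ hp
    _ = #(A.sigma D) := (card_sigma _ _).symm
    _ ≤ #(B.sigma D') := by
        refine card_le_card_of_injOn (fun z => ⟨symmDiff z.1 (sq z.2), z.2⟩) ?_ ?_
        · rintro ⟨G, z⟩ hz
          simp only [coe_sigma, Set.mem_sigma_iff, mem_coe] at hz ⊢
          exact hD G hz.1 z hz.2
        · rintro ⟨G, z⟩ _ ⟨G', z'⟩ _ h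
          simp only [Sigma.mk.injEq, heq_eq_eq] at h
          obtain ⟨h1, rfl⟩ := h
          rw [symmDiff_left_injective _ h1]
    _ = ∑ G ∈ B, #(D' G) := card_sigma _ _
    _ ≤ #B * q := by
        rw [← smul_eq_mul]; exact sum_le_card_nsmul _ _ _ hq

theorem adjPairs_univ_right {G : SimpleGraph V} {k : ℕ} (hG : G ∈ regulars V k) (S : Finset V) :
    adjPairs G S univ = #S * k := by
  rw [adjPairs_eq_sum]
  simp [mem_regulars.1 hG]

theorem adjPairs_univ_left {G : SimpleGraph V} {k : ℕ} (hG : G ∈ regulars V k) (S : Finset V) :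
    adjPairs G univ S = #S * k := by
  rw [adjPairs_comm, adjPairs_univ_right hG]

theorem card_filter_mk_mem_le {W : Type*} (P : Finset (W × W)) (F : Finset (Sym2 W))
    (h : ∀ z ∈ P, s(z.1, z.2) ∈ F) : #P ≤ 2 * #F := by
  refine card_le_mul_card_image_of_maps_to (f := fun z : W × W => s(z.1, z.2)) h 2 ?_
  intro e _
  induction e using Sym2.ind with
  | _ a b =>
  refine (card_le_card (t := {(a, b), (b, a)}) ?_).trans card_le_two
  rintro ⟨x, y⟩ hz
  simp only [mem_filter, Sym2.eq_iff] at hz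
  simp only [mem_insert, mem_singleton, Prod.mk.injEq]
  exact hz.2

/-- The `k`-regular graphs that contain all edges in `F`. -/
noncomputable def regularsContaining (k : ℕ) (F : Finset (Sym2 V)) : Finset (SimpleGraph V) :=
  {G ∈ regulars V k | ∀ e ∈ F, e ∈ G.edgeSet}

/-- Switch `uv` away against an edge `xy` outside `F`, creating `ux` and `vy`. To undo the move, `x`
must be a neighbour of `u` and `y` a neighbour of `v`, which leaves `k * k` choices. -/
theorem card_regularsContaining_insert_mul_le {k p : ℕ} {F : Finset (Sym2 V)} {u v : V}
    (he : s(u, v) ∉ F)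
    (hp : p + 2 * #F + 2 * ((k + 1) * k) ≤ Fintype.card V * k) :
    #(regularsContaining k (insert s(u, v) F)) * p ≤ #(regularsContaining k F) * (k * k) := by
  refine card_mul_le_of_switching _ _ (fun z : V × V => square u v z.1 z.2)
    (fun G => {z | Switchable G u v z.1 z.2 ∧ s(z.1, z.2) ∉ F})
    (fun G => nbrs G u ×ˢ nbrs G v) ?_ ?_ ?_
  · intro G hG
    obtain ⟨hG, hF⟩ := mem_filter.1 hG
    have huv : G.Adj u v := hF _ (mem_insert_self _ _)
    set D : Finset (V × V) := {z | Switchable G u v z.1 z.2 ∧ s(z.1, z.2) ∉ F}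
    set E : Finset (V × V) := {z ∈ univ ×ˢ univ | G.Adj z.1 z.2}
    -- The three kinds of oriented edges that cannot be used: those in `F`, those starting at `u` or
    -- next to it, and those ending at `v` or next to it.
    set E₁ : Finset (V × V) := {z | s(z.1, z.2) ∈ F}
    set E₂ : Finset (V × V) := {z ∈ insert u (nbrs G u) ×ˢ univ | G.Adj z.1 z.2}
    set E₃ : Finset (V × V) := {z ∈ univ ×ˢ insert v (nbrs G v) | G.Adj z.1 z.2}
    have hE : #E = Fintype.card V * k := adjPairs_univ_left hG univ
    have hE₁ : #E₁ ≤ 2 * #F := card_filter_mk_mem_le _ _ (by simp [E₁])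
    have hE₂ : #E₂ ≤ (k + 1) * k := by
      rw [show #E₂ = _ from adjPairs_univ_right hG _]
      refine Nat.mul_le_mul_right _ ((card_insert_le _ _).trans ?_)
      rw [mem_regulars.1 hG]
    have hE₃ : #E₃ ≤ (k + 1) * k := by
      rw [show #E₃ = _ from adjPairs_univ_left hG _]
      refine Nat.mul_le_mul_right _ ((card_insert_le _ _).trans ?_)
      rw [mem_regulars.1 hG]
    have hcov : E ⊆ D ∪ (E₁ ∪ (E₂ ∪ E₃)) := by
      rintro ⟨x, y⟩ hz
      simp only [E, D, E₁, E₂, E₃, mem_filter, mem_product, mem_univ, true_and, and_true, mem_union,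
        mem_insert, mem_nbrs] at hz ⊢
      by_cases h1 : s(x, y) ∈ F
      · tauto
      by_cases h2 : x = u ∨ G.Adj u x
      · tauto
      by_cases h3 : y = v ∨ G.Adj v y
      · tauto
      rw [not_or] at h2 h3
      exact Or.inl ⟨⟨huv, hz, h2.2, h3.2, Ne.symm h2.1, Ne.symm h3.1⟩, h1⟩
    have h1 := card_le_card hcov
    have h2 := card_union_le D (E₁ ∪ (E₂ ∪ E₃))
    have h3 := card_union_le E₁ (E₂ ∪ E₃)
    have h4 := card_union_le E₂ E₃
    omega
  · rintro G hG ⟨x, y⟩ hz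
    obtain ⟨hG, hF⟩ := mem_filter.1 hG
    simp only [mem_filter, mem_univ, true_and] at hz
    obtain ⟨hs, hxy⟩ := hz
    refine ⟨mem_filter.2 ⟨hs.mem_regulars hG, fun e heF => ?_⟩, ?_⟩
    · have h1 := hF e (mem_insert_of_mem heF)
      have h2 : e ≠ s(u, v) := fun h => he (h ▸ heF)
      have h3 : e ≠ s(x, y) := fun h => hxy (h ▸ heF)
      induction e using Sym2.ind with
      | _ a b =>
      rw [SimpleGraph.mem_edgeSet, hs.adj_iff]
      exact Or.inl ⟨h1, h2, h3⟩
    · simp only [mem_product, mem_nbrs, hs.adj_iff]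
      exact ⟨Or.inr (Or.inl trivial), Or.inr (Or.inr trivial)⟩
  · intro G hG
    have hG := mem_regulars.1 (mem_filter.1 hG).1
    rw [card_product, hG, hG]

/-- The `k`-regular graphs with few edges inside `X` and exactly `j` edges from `X` to `Y`. -/
noncomputable def regularsCrossing (k : ℕ) (X Y : Finset V) (j : ℕ) : Finset (SimpleGraph V) :=
  {G ∈ regulars V k | 2 * adjPairs G X X ≤ k * #X ∧ adjPairs G X Y = j}

/-- Switch `xa`, `yb` with `x ∈ X` and `y ∈ Y` into `xy`, `ab`. The restrictions `a ∉ X ∪ Y` and `b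
∉ X` ensure that `xy` is the only change among `X`–`Y` edges and that nothing changes inside `X`.
Undoing the move needs one of the `j + 1` crossing edges and one oriented edge of the graph. The
bound on edges inside `X` leaves enough choices for `xa`. -/
theorem card_regularsCrossing_mul_le {k w j p₁ p₂ : ℕ} {X Y : Finset V} (hX : #X = w)
    (hY : #Y = w) (hXY : Disjoint X Y) (hp₁ : 2 * p₁ + 2 * j ≤ k * w)
    (hp₂ : p₂ + j + (k + 1) * k + k * k ≤ k * w) :
    #(regularsCrossing k X Y j) * (p₁ * p₂) ≤
      #(regularsCrossing k X Y (j + 1)) * ((j + 1) * (Fintype.card V * k)) := by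
  refine card_mul_le_of_switching _ _
    (fun z : (V × V) × (V × V) => square z.1.1 z.2.1 z.1.2 z.2.2)
    (fun G => {z | z.1.1 ∈ X ∧ z.2.1 ∉ X ∧ z.2.1 ∉ Y ∧ z.1.2 ∈ Y ∧ z.2.2 ∉ X ∧
      Switchable G z.1.1 z.2.1 z.1.2 z.2.2})
    (fun G => ({z ∈ X ×ˢ Y | G.Adj z.1 z.2} : Finset (V × V)) ×ˢ
      ({z ∈ univ ×ˢ univ | G.Adj z.1 z.2} : Finset (V × V))) ?_ ?_ ?_
  · intro G hG
    obtain ⟨hG, hXX, hj⟩ := mem_filter.1 hG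
    set E₁ : Finset (V × V) := {e | e.1 ∈ X ∧ e.2 ∉ X ∧ e.2 ∉ Y ∧ G.Adj e.1 e.2} with hE₁def
    set E₂ : V × V → Finset (V × V) := fun e =>
      {f | f.1 ∈ Y ∧ f.2 ∉ X ∧ G.Adj f.1 f.2 ∧ ¬ G.Adj e.1 f.1 ∧ ¬ G.Adj e.2 f.2 ∧ e.2 ≠ f.2}
      with hE₂def
    have hE₁ : p₁ ≤ #E₁ := by
      have hcov : ({e ∈ X ×ˢ univ | G.Adj e.1 e.2} : Finset (V × V)) ⊆
          E₁ ∪ (({e ∈ X ×ˢ X | G.Adj e.1 e.2} : Finset (V × V)) ∪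
            ({e ∈ X ×ˢ Y | G.Adj e.1 e.2} : Finset (V × V))) := by
        intro e he
        simp only [hE₁def, mem_filter, mem_product, mem_univ, and_true, true_and, mem_union]
          at he ⊢
        tauto
      have h1 := (card_le_card hcov).trans ((card_union_le _ _).trans
        (Nat.add_le_add_left (card_union_le _ _) _))
      have h2 : adjPairs G X univ ≤ #E₁ + (adjPairs G X X + adjPairs G X Y) := h1
      rw [adjPairs_univ_right hG, hX, hj, mul_comm] at h2
      rw [hX] at hXX
      omega
    have hE₂ : ∀ e, p₂ ≤ #(E₂ e) := by
      intro e
      have hcov : ({f ∈ Y ×ˢ univ | G.Adj f.1 f.2} : Finset (V × V)) ⊆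
          E₂ e ∪ (({f ∈ Y ×ˢ X | G.Adj f.1 f.2} : Finset (V × V)) ∪
            (({f ∈ univ ×ˢ insert e.2 (nbrs G e.2) | G.Adj f.1 f.2} : Finset (V × V)) ∪
              ({f ∈ nbrs G e.1 ×ˢ univ | G.Adj f.1 f.2} : Finset (V × V)))) := by
        intro f hf
        simp only [hE₂def, mem_filter, mem_product, mem_univ, and_true, true_and, mem_union,
          mem_insert, mem_nbrs] at hf ⊢
        by_cases h1 : f.2 ∈ X
        · tauto
        by_cases h2 : f.2 = e.2
        · tauto
        have h2' : e.2 ≠ f.2 := Ne.symm h2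
        tauto
      have h1 := (card_le_card hcov).trans ((card_union_le _ _).trans
        (Nat.add_le_add_left ((card_union_le _ _).trans
          (Nat.add_le_add_left (card_union_le _ _) _)) _))
      have h2 : adjPairs G Y univ ≤ #(E₂ e) + (adjPairs G Y X +
        (adjPairs G univ (insert e.2 (nbrs G e.2)) + adjPairs G (nbrs G e.1) univ)) := h1
      rw [adjPairs_univ_right hG, adjPairs_univ_right hG, adjPairs_univ_left hG,
        adjPairs_comm G Y X, hj, hY, mem_regulars.1 hG] at h2
      have h3 : #(insert e.2 (nbrs G e.2)) * k ≤ (k + 1) * k := by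
        refine Nat.mul_le_mul_right _ ((card_insert_le _ _).trans ?_)
        rw [mem_regulars.1 hG]
      rw [mul_comm w k] at h2
      omega
    calc p₁ * p₂ ≤ #E₁ * p₂ := Nat.mul_le_mul_right _ hE₁
      _ ≤ ∑ e ∈ E₁, #(E₂ e) := by
          rw [← smul_eq_mul]; exact card_nsmul_le_sum _ _ _ fun e _ => hE₂ e
      _ = #(E₁.sigma E₂) := (card_sigma _ _).symm
      _ ≤ _ := by
          refine card_le_card_of_injOn
            (fun z => ((z.1.1, z.2.1), (z.1.2, z.2.2))) ?_ ?_
          · rintro ⟨⟨x, a⟩, ⟨y, b⟩⟩ hz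
            simp only [coe_sigma, Set.mem_sigma_iff, hE₁def, hE₂def, mem_univ, true_and,
              coe_filter, Set.mem_ofPred_eq] at hz ⊢
            obtain ⟨⟨h1, h2, h3, h4⟩, h5, h6, h7, h8, h9, h10⟩ := hz
            exact ⟨h1, h2, h3, h5, h6, h4, h7, h8, h9,
              fun h => Finset.disjoint_left.1 hXY h1 (h ▸ h5), h10⟩
          · rintro ⟨⟨x, a⟩, ⟨y, b⟩⟩ _ ⟨⟨x₁, a₁⟩, ⟨y₁, b₁⟩⟩ _ h
            simp only [Prod.mk.injEq] at h
            obtain ⟨⟨rfl, rfl⟩, rfl, rfl⟩ := h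
            rfl
  · rintro G hG ⟨⟨x, y⟩, ⟨a, b⟩⟩ hz
    obtain ⟨hG, hXX, hj⟩ := mem_filter.1 hG
    simp only [mem_filter, mem_univ, true_and] at hz
    obtain ⟨hx, haX, haY, hy, hbX, hs⟩ := hz
    have hyX : y ∉ X := fun h => Finset.disjoint_left.1 hXY h hy
    have hxY : x ∉ Y := fun h => Finset.disjoint_left.1 hXY hx h
    refine ⟨mem_filter.2 ⟨hs.mem_regulars hG, ?_, ?_⟩, ?_⟩
    · convert hXX using 2
      unfold adjPairs
      congr 1
      ext ⟨p, q⟩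
      simp only [mem_filter, mem_product, hs.adj_iff, ne_eq, Sym2.eq_iff]
      grind
    · have : ({z ∈ X ×ˢ Y | (symmDiff G (square x a y b)).Adj z.1 z.2} : Finset (V × V)) =
          insert (x, y) ({z ∈ X ×ˢ Y | G.Adj z.1 z.2} : Finset (V × V)) := by
        ext ⟨p, q⟩
        simp only [mem_filter, mem_product, hs.adj_iff, ne_eq, Sym2.eq_iff, mem_insert,
          Prod.mk.injEq]
        grind
      rw [adjPairs, this, card_insert_of_notMem (by
        simp only [mem_filter, not_and]; exact fun _ => hs.2.2.1)]
      rw [← hj]; rfl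
    · simp only [mem_product, mem_filter, mem_univ, true_and, hs.adj_iff]
      exact ⟨⟨⟨hx, hy⟩, Or.inr (Or.inl trivial)⟩, Or.inr (Or.inr trivial)⟩
  · intro G hG
    obtain ⟨hG, hXX, hj⟩ := mem_filter.1 hG
    rw [card_product]
    have h1 : #({z ∈ univ ×ˢ univ | G.Adj z.1 z.2} : Finset (V × V)) = Fintype.card V * k :=
      adjPairs_univ_left hG univ
    rw [h1, show #({z ∈ X ×ˢ Y | G.Adj z.1 z.2} : Finset (V × V)) = j + 1 from hj]

end Switching

/-! ### First moment bounds for the two pseudorandom properties -/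

section Counting

open scoped Classical

variable {V : Type*} [Fintype V]

theorem choose_le_pow_three_mul_div {a m : ℕ} (hm : 0 < m) :
    (a.choose m : ℝ) ≤ (3 * a / m) ^ m := by
  have hm' : (0 : ℝ) < m := by exact_mod_cast hm
  have h1 : (a.choose m : ℝ) ≤ (a : ℝ) ^ m / m.factorial := Nat.choose_le_pow_div m a
  have h2 : (m : ℝ) ^ m / m.factorial ≤ Real.exp m := Real.pow_div_factorial_le_exp _ hm'.le m
  have h3 : Real.exp m ≤ 3 ^ m := by
    rw [← mul_one (m : ℝ), Real.exp_nat_mul]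
    exact pow_le_pow_left₀ (Real.exp_pos _).le Real.exp_one_lt_three.le _
  calc (a.choose m : ℝ) ≤ (a : ℝ) ^ m / m.factorial := h1
    _ = ((m : ℝ) ^ m / m.factorial) * ((a : ℝ) ^ m / (m : ℝ) ^ m) := by
        field_simp
    _ ≤ 3 ^ m * ((a : ℝ) ^ m / (m : ℝ) ^ m) := by
        gcongr; exact h2.trans h3
    _ = (3 * a / m) ^ m := by rw [← div_pow, ← mul_pow, mul_div_assoc]

/-- Edges are added to `F` one at a time. The size conditions keep at least half of the `n * k`
oriented edges available for switching, so each new edge costs a factor `k * k / (n * k / 2) = 2 * k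
/ n`. -/
theorem card_regularsContaining_le {k : ℕ} (hk : 0 < k) (hn : 8 * (k + 1) ≤ Fintype.card V)
    (F : Finset (Sym2 V)) (hF : 8 * #F ≤ Fintype.card V * k) :
    (#(regularsContaining k F) : ℝ) ≤ (2 * k / Fintype.card V) ^ #F * #(regulars V k) := by
  set n := Fintype.card V with hndef
  have hn0 : (0 : ℝ) < n := by
    have : 0 < n := by omega
    exact_mod_cast this
  have hk0 : (0 : ℝ) < k := by exact_mod_cast hk
  induction F using Finset.induction_on with
  | empty =>
    simp only [card_empty, pow_zero, one_mul]
    exact_mod_cast card_le_card (filter_subset _ _)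
  | insert e F he ih =>
    rw [card_insert_of_notMem he] at hF ⊢
    have ih' := ih (by omega)
    induction e using Sym2.ind with
    | _ u v =>
    have hnk : 8 * (k + 1) * k ≤ n * k := Nat.mul_le_mul_right _ hn
    obtain ⟨p, hp⟩ : ∃ p, p + 2 * #F + 2 * ((k + 1) * k) = n * k :=
      ⟨n * k - (2 * #F + 2 * ((k + 1) * k)), by
        have : 8 * (k + 1) * k = 8 * ((k + 1) * k) := by ring
        omega⟩
    have h2p : n * k ≤ 2 * p := by
      have : 8 * (k + 1) * k = 8 * ((k + 1) * k) := by ring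
      omega
    have h1 := card_regularsContaining_insert_mul_le (V := V) (k := k) he hp.le
    have h1' : (#(regularsContaining k (insert s(u, v) F)) : ℝ) * p ≤
        #(regularsContaining k F) * (k * k) := by exact_mod_cast h1
    have h2p' : (n : ℝ) * k ≤ 2 * p := by exact_mod_cast h2p
    have h3 : (#(regularsContaining k (insert s(u, v) F)) : ℝ) * (n * k) ≤
        #(regularsContaining k F) * (2 * k) * k := by
      have : (0 : ℝ) ≤ #(regularsContaining k (insert s(u, v) F)) := Nat.cast_nonneg _
      nlinarith
    have h4 : (#(regularsContaining k (insert s(u, v) F)) : ℝ) * n ≤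
        #(regularsContaining k F) * (2 * k) := by
      refine le_of_mul_le_mul_right ?_ hk0
      linarith
    calc (#(regularsContaining k (insert s(u, v) F)) : ℝ)
        ≤ #(regularsContaining k F) * (2 * k) / n := by rwa [le_div_iff₀ hn0]
      _ = 2 * k / n * #(regularsContaining k F) := by ring
      _ ≤ 2 * k / n * ((2 * k / n) ^ #F * #(regulars V k)) := by gcongr
      _ = _ := by ring

/-- A first moment bound for the number of regular graphs with many edges inside `S`. -/
theorem card_dense_le {k m : ℕ} (hk : 0 < k) (hm : 0 < m) (hn : 8 * (k + 1) ≤ Fintype.card V)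
    (hmk : 8 * m ≤ Fintype.card V * k) (S : Finset V) :
    (#{G ∈ regulars V k | 2 * m ≤ adjPairs G S S + 1} : ℝ) ≤
      (6 * k * #S ^ 2 / (m * Fintype.card V)) ^ m * #(regulars V k) := by
  rcases S.eq_empty_or_nonempty with rfl | hS
  · have : ({G ∈ regulars V k | 2 * m ≤ adjPairs G ∅ ∅ + 1} : Finset (SimpleGraph V)) = ∅ := by
      refine filter_eq_empty_iff.2 fun G _ => ?_
      simp only [adjPairs, empty_product, filter_empty, card_empty]
      omega
    rw [this, card_empty, Nat.cast_zero]
    positivity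
  have hcov : ({G ∈ regulars V k | 2 * m ≤ adjPairs G S S + 1} : Finset (SimpleGraph V)) ⊆
      (powersetCard m S.sym2).biUnion fun F => regularsContaining k F := by
    intro G hG
    obtain ⟨hG, hGm⟩ := mem_filter.1 hG
    have h1 : adjPairs G S S ≤ 2 * #{e ∈ S.sym2 | e ∈ G.edgeSet} := by
      refine card_filter_mk_mem_le _ _ ?_
      rintro ⟨x, y⟩ hz
      simp only [mem_filter, mem_product] at hz
      simp only [mem_filter, mk_mem_sym2_iff, SimpleGraph.mem_edgeSet]
      exact hz
    obtain ⟨F, hF, hFm⟩ := exists_subset_card_eq (n := m) (s := {e ∈ S.sym2 | e ∈ G.edgeSet})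
      (by omega)
    refine mem_biUnion.2 ⟨F, mem_powersetCard.2 ⟨hF.trans (filter_subset _ _), hFm⟩, ?_⟩
    exact mem_filter.2 ⟨hG, fun e he => (mem_filter.1 (hF he)).2⟩
  have hs1 : 1 ≤ #S := card_pos.2 hS
  have hsym : #S.sym2 ≤ #S ^ 2 := by
    rw [card_sym2, Nat.choose_two_right]
    refine Nat.div_le_of_le_mul ?_
    simp only [Nat.add_sub_cancel]
    nlinarith
  have h1 : (#{G ∈ regulars V k | 2 * m ≤ adjPairs G S S + 1} : ℝ) ≤
      ∑ F ∈ powersetCard m S.sym2, (#(regularsContaining k F) : ℝ) := by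
    exact_mod_cast (card_le_card hcov).trans card_biUnion_le
  calc (#{G ∈ regulars V k | 2 * m ≤ adjPairs G S S + 1} : ℝ)
      ≤ ∑ F ∈ powersetCard m S.sym2, (2 * k / Fintype.card V : ℝ) ^ m * #(regulars V k) := by
        refine h1.trans (sum_le_sum fun F hF => ?_)
        have hFm := (mem_powersetCard.1 hF).2
        have := card_regularsContaining_le hk hn F (by rw [hFm]; exact hmk)
        rwa [hFm] at this
    _ = ((#S.sym2).choose m : ℝ) * ((2 * k / Fintype.card V : ℝ) ^ m * #(regulars V k)) := by
        rw [sum_const, card_powersetCard, nsmul_eq_mul]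
    _ ≤ (3 * (#S.sym2 : ℕ) / m) ^ m * ((2 * k / Fintype.card V : ℝ) ^ m * #(regulars V k)) := by
        gcongr
        exact choose_le_pow_three_mul_div hm
    _ ≤ (3 * (#S ^ 2 : ℕ) / m) ^ m * ((2 * k / Fintype.card V : ℝ) ^ m * #(regulars V k)) := by
        gcongr
    _ = _ := by
        rw [← mul_assoc, ← mul_pow]
        congr 2
        push_cast
        rw [div_mul_div_comm]
        congr 1
        ring

/-- Union bound over the sets of size `s + 1 ≤ 2 * w`. Since `δ ≥ 4`, a dense set forces at least `2
* (s + 1)` edges. These absorb the binomial coefficient, and what remains decays geometrically in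
`s` with leading term of order `d / n`. -/
theorem card_not_locallySparse_le {k d δ w : ℕ} (hd : 0 < d) (hk8 : k ≤ 8 * d * δ)
    (hk4 : 4 * d * δ ≤ k) (hδ4 : 4 ≤ δ) (hn : 8 * (k + 1) ≤ Fintype.card V)
    (hw : 768 * d * w ≤ Fintype.card V) (hδ : 4608 * d ≤ 2 ^ δ) :
    (#{G ∈ regulars V k | ¬ LocallySparse G δ w} : ℝ) ≤
      192 * d / Fintype.card V * #(regulars V k) := by
  set n := Fintype.card V with hndef
  have hn0 : (0 : ℝ) < n := by
    have : 0 < n := by omega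
    exact_mod_cast this
  have hd0 : (0 : ℝ) < d := by exact_mod_cast hd
  have hδk : δ ≤ k := by nlinarith
  have hk : 0 < k := by omega
  have hcov : ({G ∈ regulars V k | ¬ LocallySparse G δ w} : Finset (SimpleGraph V)) ⊆
      (range (2 * w)).biUnion fun s => (powersetCard (s + 1) (univ : Finset V)).biUnion fun S =>
        ({G ∈ regulars V k | 2 * ((δ * (s + 1) + 1) / 2) ≤ adjPairs G S S + 1} :
          Finset (SimpleGraph V)) := by
    intro G hG
    obtain ⟨hG, hG'⟩ := mem_filter.1 hG
    simp only [LocallySparse, not_forall, not_lt] at hG'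
    obtain ⟨S, hS, hSw, hle⟩ := hG'
    have hS1 := card_pos.2 hS
    refine mem_biUnion.2 ⟨#S - 1, mem_range.2 (by omega), mem_biUnion.2
      ⟨S, mem_powersetCard.2 ⟨subset_univ _, by omega⟩, mem_filter.2 ⟨hG, ?_⟩⟩⟩
    rw [Nat.sub_add_cancel hS1]
    omega
  have hterm : ∀ s ∈ range (2 * w), ∀ S ∈ powersetCard (s + 1) (univ : Finset V),
      (#({G ∈ regulars V k | 2 * ((δ * (s + 1) + 1) / 2) ≤ adjPairs G S S + 1} :
          Finset (SimpleGraph V)) : ℝ) ≤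
        (96 * d * (s + 1 : ℕ) / n) ^ ((δ * (s + 1) + 1) / 2) * #(regulars V k) := by
    intro s hs S hS
    have hScard := (mem_powersetCard.1 hS).2
    have hs := mem_range.1 hs
    set m := (δ * (s + 1) + 1) / 2 with hm
    have hδs : 4 ≤ δ * (s + 1) := by nlinarith
    have hm0 : 0 < m := by omega
    have hm2 : δ * (s + 1) ≤ 2 * m := by omega
    have hmk : 8 * m ≤ n * k := by
      have h1 : m ≤ δ * (s + 1) := by omega
      have h2 : δ * (s + 1) ≤ k * (2 * w) := Nat.mul_le_mul hδk (by omega)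
      have h3 : 16 * w ≤ n := by nlinarith
      calc 8 * m ≤ 8 * (k * (2 * w)) := by omega
        _ = 16 * w * k := by ring
        _ ≤ n * k := Nat.mul_le_mul_right _ h3
    have h1 := card_dense_le hk hm0 hn hmk S
    rw [hScard] at h1
    have hm0' : (0 : ℝ) < m := by exact_mod_cast hm0
    refine h1.trans (mul_le_mul_of_nonneg_right (pow_le_pow_left₀ (by positivity) ?_ _)
      (Nat.cast_nonneg _))
    rw [← hndef]
    rw [div_le_div_iff₀ (by positivity) hn0]
    have h2 : (k : ℝ) * (s + 1 : ℕ) ≤ 16 * d * m := by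
      have : k * (s + 1) ≤ 16 * d * m := by
        calc k * (s + 1) ≤ 8 * d * δ * (s + 1) := Nat.mul_le_mul_right _ hk8
          _ = 8 * d * (δ * (s + 1)) := by ring
          _ ≤ 8 * d * (2 * m) := Nat.mul_le_mul_left _ hm2
          _ = 16 * d * m := by ring
      exact_mod_cast this
    calc 6 * (k : ℝ) * ((s + 1 : ℕ) : ℝ) ^ 2 * n
        = 6 * ((s + 1 : ℕ) : ℝ) * n * (k * (s + 1 : ℕ)) := by ring
      _ ≤ 6 * ((s + 1 : ℕ) : ℝ) * n * (16 * d * m) := by gcongr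
      _ = _ := by ring
  have hbound : ∀ s ∈ range (2 * w), (n.choose (s + 1) : ℝ) *
      (96 * d * (s + 1 : ℕ) / n) ^ ((δ * (s + 1) + 1) / 2) ≤ 96 * d / n * (1 / 2) ^ s := by
    intro s hs
    have hs := mem_range.1 hs
    set m := (δ * (s + 1) + 1) / 2 with hm
    set q : ℝ := 96 * d * (s + 1 : ℕ) / n with hq
    have hs0 : (0 : ℝ) < (s + 1 : ℕ) := by positivity
    have hq0 : 0 < q := by positivity
    have hq4 : q ≤ 1 / 4 := by
      rw [hq, div_le_iff₀ hn0]
      have : 384 * d * (s + 1) ≤ n := by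
        calc 384 * d * (s + 1) ≤ 384 * d * (2 * w) := Nat.mul_le_mul_left _ (by omega)
          _ = 768 * d * w := by ring
          _ ≤ n := hw
      have : (384 : ℝ) * d * (s + 1 : ℕ) ≤ n := by exact_mod_cast this
      linarith
    have hδs : 4 * (s + 1) ≤ δ * (s + 1) := Nat.mul_le_mul_right _ hδ4
    -- The binomial coefficient is at most `(288 * d / q) ^ (s + 1)`. The factor `q ^ (2 * (s + 1))`
    -- cancels the denominator with `q ^ (s + 1)` to spare, and `q ^ r` beats `(288 * d) ^ (s + 1)`
    -- because `288 * 2 ^ 4 * d = 4608 * d ≤ 2 ^ δ`.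
    obtain ⟨r, hr⟩ : ∃ r, m = 2 * (s + 1) + r := ⟨m - 2 * (s + 1), by omega⟩
    have hr2 : (δ - 4) * (s + 1) ≤ 2 * r := by
      rw [Nat.sub_mul]; omega
    have hqr : q ^ r ≤ ((1 / 2 : ℝ) ^ (δ - 4)) ^ (s + 1) := by
      calc q ^ r ≤ (1 / 4) ^ r := pow_le_pow_left₀ hq0.le hq4 _
        _ = (1 / 2 : ℝ) ^ (2 * r) := by rw [pow_mul]; norm_num
        _ ≤ (1 / 2 : ℝ) ^ ((δ - 4) * (s + 1)) :=
            pow_le_pow_of_le_one (by norm_num) (by norm_num) hr2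
        _ = _ := by rw [pow_mul]
    have hsmall : 288 * d * (1 / 2 : ℝ) ^ (δ - 4) ≤ 1 := by
      have h1 : (4608 : ℝ) * d ≤ 2 ^ δ := by exact_mod_cast hδ
      have h2 : (2 : ℝ) ^ δ = 2 ^ (δ - 4) * 16 := by
        rw [show (16 : ℝ) = 2 ^ 4 by norm_num, ← pow_add, Nat.sub_add_cancel hδ4]
      rw [one_div, inv_pow, ← div_eq_mul_inv, div_le_one (by positivity)]
      linarith
    have hch : (n.choose (s + 1) : ℝ) ≤ (288 * d / q) ^ (s + 1) := by
      refine (choose_le_pow_three_mul_div (Nat.succ_pos s)).trans (le_of_eq ?_)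
      congr 1
      rw [hq]
      field_simp
      norm_num
    have hs2 : ((s + 1 : ℕ) : ℝ) ≤ 2 ^ s := by
      exact_mod_cast Nat.lt_two_pow_self (n := s)
    calc (n.choose (s + 1) : ℝ) * q ^ m
        ≤ (288 * d / q) ^ (s + 1) * q ^ m := by gcongr
      _ = (288 * d / q) ^ (s + 1) * (q ^ 2) ^ (s + 1) * q ^ r := by
          rw [hr, pow_add q, pow_mul, mul_assoc]
      _ = (288 * d * q) ^ (s + 1) * q ^ r := by
          rw [← mul_pow]
          congr 2
          field_simp
      _ ≤ (288 * d * q) ^ (s + 1) * ((1 / 2 : ℝ) ^ (δ - 4)) ^ (s + 1) := by gcongr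
      _ = (288 * d * (1 / 2 : ℝ) ^ (δ - 4) * q) ^ (s + 1) := by
          rw [← mul_pow]; congr 1; ring
      _ ≤ (1 * q) ^ (s + 1) := by gcongr
      _ = q * q ^ s := by rw [one_mul, pow_succ, mul_comm]
      _ ≤ q * (1 / 4) ^ s := by gcongr
      _ = 96 * d / n * (s + 1 : ℕ) * (1 / 4) ^ s := by rw [hq]; ring
      _ ≤ 96 * d / n * 2 ^ s * (1 / 4) ^ s := by gcongr
      _ = 96 * d / n * (1 / 2) ^ s := by
          rw [mul_assoc, ← mul_pow]; norm_num
  have hgeom : ∑ s ∈ range (2 * w), (1 / 2 : ℝ) ^ s ≤ 2 := sum_geometric_two_le _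
  calc (#{G ∈ regulars V k | ¬ LocallySparse G δ w} : ℝ)
      ≤ ∑ s ∈ range (2 * w), ∑ S ∈ powersetCard (s + 1) (univ : Finset V),
        (#({G ∈ regulars V k | 2 * ((δ * (s + 1) + 1) / 2) ≤ adjPairs G S S + 1} :
          Finset (SimpleGraph V)) : ℝ) := by
        exact_mod_cast (card_le_card hcov).trans (card_biUnion_le.trans
          (sum_le_sum fun s _ => card_biUnion_le))
    _ ≤ ∑ s ∈ range (2 * w), ∑ S ∈ powersetCard (s + 1) (univ : Finset V),
        (96 * d * (s + 1 : ℕ) / n : ℝ) ^ ((δ * (s + 1) + 1) / 2) * #(regulars V k) :=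
        sum_le_sum fun s hs => sum_le_sum fun S hS => hterm s hs S hS
    _ = ∑ s ∈ range (2 * w), (n.choose (s + 1) : ℝ) *
        (96 * d * (s + 1 : ℕ) / n) ^ ((δ * (s + 1) + 1) / 2) * #(regulars V k) := by
        refine sum_congr rfl fun s _ => ?_
        rw [sum_const, card_powersetCard, card_univ, nsmul_eq_mul, ← hndef]
        exact (mul_assoc _ _ _).symm
    _ ≤ ∑ s ∈ range (2 * w), 96 * d / n * (1 / 2 : ℝ) ^ s * #(regulars V k) := by
        refine sum_le_sum fun s hs => ?_
        exact mul_le_mul_of_nonneg_right (hbound s hs) (Nat.cast_nonneg _)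
    _ = 96 * d / n * (∑ s ∈ range (2 * w), (1 / 2 : ℝ) ^ s) * #(regulars V k) := by
        rw [← sum_mul, ← mul_sum]
    _ ≤ 96 * d / n * 2 * #(regulars V k) := by gcongr
    _ = _ := by ring

/-- As long as `j < J`, passing from `j` to `j + 1` crossing edges at least doubles the number of
graphs, so having none is exponentially unlikely in `J`. -/
theorem card_regularsCrossing_zero_mul_le {k w J : ℕ} {X Y : Finset V} (hX : #X = w)
    (hY : #Y = w) (hXY : Disjoint X Y) (hJ : 8 * J ≤ k * w)
    (hkw : 8 * ((k + 1) * k + k * k) ≤ k * w) (hk : 0 < k)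
    (hJn : 64 * J * Fintype.card V ≤ k * w ^ 2) :
    #(regularsCrossing k X Y 0) * 2 ^ J ≤ #(regulars V k) := by
  have key : ∀ j ≤ J, #(regularsCrossing k X Y 0) * 2 ^ j ≤ #(regularsCrossing k X Y j) := by
    intro j
    induction j with
    | zero => simp
    | succ j ih =>
      intro hj
      have h0 := ih (by omega)
      have h6 : 6 ≤ k * w := by nlinarith
      -- The divisions round down; the weaker constants `8` and `4` absorb the loss, and `8 * 4 * 2
      -- = 64` is the constant in `hJn`.
      have hp₁ : k * w ≤ 8 * (k * w / 4) := by omega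
      have hp₂ : k * w ≤ 4 * (k * w / 2) := by omega
      have h1 := card_regularsCrossing_mul_le (k := k) (j := j) (p₁ := k * w / 4)
        (p₂ := k * w / 2) hX hY hXY (by omega) (by omega)
      have h2 : #(regularsCrossing k X Y j) * (k * w * (k * w)) ≤
          32 * (#(regularsCrossing k X Y (j + 1)) * ((j + 1) * (Fintype.card V * k))) := by
        calc #(regularsCrossing k X Y j) * (k * w * (k * w))
            ≤ #(regularsCrossing k X Y j) * ((8 * (k * w / 4)) * (4 * (k * w / 2))) := by gcongr
          _ = 32 * (#(regularsCrossing k X Y j) * (k * w / 4 * (k * w / 2))) := by ring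
          _ ≤ _ := Nat.mul_le_mul_left _ h1
      have h3 : 2 * #(regularsCrossing k X Y j) ≤ #(regularsCrossing k X Y (j + 1)) := by
        refine Nat.le_of_mul_le_mul_right ?_ (show 0 < k * w * (k * w) by positivity)
        calc 2 * #(regularsCrossing k X Y j) * (k * w * (k * w))
            ≤ 2 * (32 * (#(regularsCrossing k X Y (j + 1)) *
              ((j + 1) * (Fintype.card V * k)))) := by
              rw [mul_assoc]; exact Nat.mul_le_mul_left _ h2
          _ = #(regularsCrossing k X Y (j + 1)) * (64 * (j + 1) * Fintype.card V * k) := by ring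
          _ ≤ #(regularsCrossing k X Y (j + 1)) * (k * w ^ 2 * k) := by
              refine Nat.mul_le_mul_left _ (Nat.mul_le_mul_right _ (le_trans ?_ hJn))
              gcongr
          _ = _ := by ring
      calc #(regularsCrossing k X Y 0) * 2 ^ (j + 1)
          = 2 * (#(regularsCrossing k X Y 0) * 2 ^ j) := by ring
        _ ≤ 2 * #(regularsCrossing k X Y j) := Nat.mul_le_mul_left _ h0
        _ ≤ _ := h3
  exact (key J le_rfl).trans (card_le_card (filter_subset _ _))

/-- At most `(4608 * d) ^ (2 * w)` pairs compete with a probability `2 ^ (-T * w)` each. Local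
sparsity is kept in the event because it supplies the bound on edges inside `X` that the crossing
switchings require. -/
theorem card_locallySparse_not_joined_le {k d δ w T : ℕ} (hd : 0 < d)
    (hk4 : 4 * d * δ ≤ k) (hδ0 : 0 < δ) (hw : 8 * (2 * k + 1) ≤ w)
    (hnw : Fintype.card V ≤ 1536 * d * w) (hT : 24576 * T ≤ δ)
    (hT2 : 2 * (4608 * d) ^ 2 ≤ 2 ^ T) :
    (#{G ∈ regulars V k | LocallySparse G δ w ∧ ¬ Joined G w} : ℝ) ≤
      (1 / 2) ^ w * #(regulars V k) := by
  set n := Fintype.card V with hndef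
  have h2δk : 4 * δ ≤ k := by nlinarith
  have hk : 0 < k := by omega
  have hw0 : 0 < w := by omega
  have hw0' : (0 : ℝ) < w := by exact_mod_cast hw0
  have hcov : ({G ∈ regulars V k | LocallySparse G δ w ∧ ¬ Joined G w} :
      Finset (SimpleGraph V)) ⊆
      ((powersetCard w univ ×ˢ powersetCard w univ).filter
        fun Z : Finset V × Finset V => Disjoint Z.1 Z.2).biUnion fun Z =>
          regularsCrossing k Z.1 Z.2 0 := by
    intro G hG
    obtain ⟨hG, hsp, hj⟩ := mem_filter.1 hG
    simp only [Joined, not_forall, not_not] at hj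
    obtain ⟨X, Y, hX, hY, hXY, h0⟩ := hj
    refine mem_biUnion.2 ⟨(X, Y), ?_, mem_filter.2 ⟨hG, ?_, h0⟩⟩
    · simp only [mem_filter, mem_product, mem_powersetCard, subset_univ, true_and]
      exact ⟨⟨hX, hY⟩, hXY⟩
    · have h1 := hsp X (card_pos.1 (by omega)) (by omega)
      have h2 : 4 * δ * #X ≤ k * #X := Nat.mul_le_mul_right _ h2δk
      nlinarith
  have hone : ∀ Z ∈ (powersetCard w univ ×ˢ powersetCard w univ).filter
        fun Z : Finset V × Finset V => Disjoint Z.1 Z.2,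
      (#(regularsCrossing k Z.1 Z.2 0) : ℝ) ≤ (1 / 2) ^ (T * w) * #(regulars V k) := by
    intro Z hZ
    simp only [mem_filter, mem_product, mem_powersetCard, subset_univ, true_and] at hZ
    obtain ⟨⟨hX, hY⟩, hXY⟩ := hZ
    have hTw : 24576 * (T * w) ≤ δ * w := by
      rw [← mul_assoc]; exact Nat.mul_le_mul_right _ hT
    have h4 : 4 * (δ * w) ≤ k * w := by
      rw [← mul_assoc]; exact Nat.mul_le_mul_right _ h2δk
    have h := card_regularsCrossing_zero_mul_le (k := k) (J := T * w) hX hY hXY (by omega)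
      (by
        calc 8 * ((k + 1) * k + k * k) = k * (8 * (2 * k + 1)) := by ring
          _ ≤ k * w := Nat.mul_le_mul_left _ hw) hk
      (by
        calc 64 * (T * w) * n ≤ 64 * (T * w) * (1536 * d * w) := Nat.mul_le_mul_left _ hnw
          _ = 4 * d * (24576 * (T * w)) * w := by ring
          _ ≤ 4 * d * (δ * w) * w := by gcongr
          _ = 4 * d * δ * w ^ 2 := by ring
          _ ≤ k * w ^ 2 := Nat.mul_le_mul_right _ hk4)
    have h' : (#(regularsCrossing k Z.1 Z.2 0) : ℝ) * 2 ^ (T * w) ≤ #(regulars V k) := by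
      exact_mod_cast h
    rw [one_div, inv_pow, inv_mul_eq_div, le_div_iff₀ (by positivity)]
    exact h'
  have hch : (n.choose w : ℝ) ≤ (4608 * d) ^ w := by
    refine (choose_le_pow_three_mul_div hw0).trans ?_
    gcongr
    rw [div_le_iff₀ hw0']
    have : (n : ℝ) ≤ 1536 * d * w := by exact_mod_cast hnw
    linarith
  have hT2' : (2 : ℝ) * (4608 * d) ^ 2 ≤ 2 ^ T := by exact_mod_cast hT2
  calc (#{G ∈ regulars V k | LocallySparse G δ w ∧ ¬ Joined G w} : ℝ)
      ≤ ∑ Z ∈ (powersetCard w univ ×ˢ powersetCard w univ).filter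
        (fun Z : Finset V × Finset V => Disjoint Z.1 Z.2),
          (#(regularsCrossing k Z.1 Z.2 0) : ℝ) := by
        exact_mod_cast (card_le_card hcov).trans card_biUnion_le
    _ ≤ #((powersetCard w univ ×ˢ powersetCard w univ).filter
        (fun Z : Finset V × Finset V => Disjoint Z.1 Z.2)) *
          ((1 / 2) ^ (T * w) * #(regulars V k)) := by
        rw [← nsmul_eq_mul]; exact sum_le_card_nsmul _ _ _ hone
    _ ≤ ((n.choose w : ℝ) * n.choose w) * ((1 / 2) ^ (T * w) * #(regulars V k)) := by
        gcongr
        have := card_filter_le ((powersetCard w univ ×ˢ powersetCard w univ) :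
          Finset (Finset V × Finset V)) (fun Z => Disjoint Z.1 Z.2)
        rw [card_product, card_powersetCard, card_univ] at this
        exact_mod_cast this
    _ ≤ ((4608 * d) ^ w * (4608 * d) ^ w) * ((1 / 2) ^ (T * w) * #(regulars V k)) := by
        gcongr
    _ = ((4608 * d) ^ 2 * (1 / 2) ^ T) ^ w * #(regulars V k) := by
        rw [pow_mul, mul_pow ((4608 * d : ℝ) ^ 2), sq, mul_pow (4608 * d : ℝ) (4608 * d),
          mul_assoc, mul_assoc, mul_assoc]
    _ ≤ (1 / 2) ^ w * #(regulars V k) := by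
        gcongr
        rw [one_div, inv_pow, ← div_eq_mul_inv, div_le_iff₀ (by positivity)]
        linarith

end Counting

/-! ### Probabilities, choice of parameters and the limit -/

section RandomRegular

open scoped Classical

/-- A Cayley graph: a symmetric set of `k` nonzero elements gives a `k`-regular graph. -/
theorem exists_mem_regulars_of_symmetric {A : Type*} [Fintype A] [AddCommGroup A] {k : ℕ}
    (T : Finset A) (h0 : (0 : A) ∉ T) (hT : ∀ a ∈ T, -a ∈ T) (hk : #T = k) :
    ∃ G : SimpleGraph A, G ∈ regulars A k := by
  refine ⟨{ Adj := fun u v => v - u ∈ T, symm := ⟨fun u v h => ?_⟩, loopless := ⟨fun u h => ?_⟩ },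
    mem_regulars.2 fun v => ?_⟩
  · have := hT _ h
    rwa [neg_sub] at this
  · rw [sub_self] at h
    exact h0 h
  · rw [← hk, ← card_image_of_injective T (add_right_injective v)]
    congr 1
    ext u
    simp only [mem_nbrs, mem_image]
    constructor
    · intro h
      exact ⟨_, h, by abel⟩
    · rintro ⟨a, ha, rfl⟩
      rwa [add_sub_cancel_left]

/-- The circulant graph with differences `±1, …, ±(k / 2)`, together with `n / 2` when `k` is odd,
in which case `n` is even. Without such a graph `regularProb` would be `0 / 0 = 0`. -/
theorem regulars_fin_nonempty {n k : ℕ} (hn : 2 * k + 2 ≤ n) (he : Even (n * k)) :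
    (regulars (Fin n) k).Nonempty := by
  have : NeZero n := ⟨by omega⟩
  have hneg : ∀ i : Fin n, i ≠ 0 → ((-i : Fin n) : ℕ) = n - i := by
    intro i hi
    rw [Fin.val_neg, if_neg hi]
  set h := k / 2 with hh
  set T : Finset (Fin n) := {i | (1 ≤ (i : ℕ) ∧ (i : ℕ) ≤ h) ∨ n - h ≤ (i : ℕ) ∨
    (k % 2 = 1 ∧ 2 * (i : ℕ) = n)} with hT
  refine exists_mem_regulars_of_symmetric T ?_ ?_ ?_
  · simp only [hT, mem_filter, mem_univ, true_and, Fin.val_zero]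
    omega
  · intro i hi
    have hi0 : i ≠ 0 := by
      rintro rfl
      simp only [hT, mem_filter, mem_univ, true_and, Fin.val_zero] at hi
      omega
    have hi1 : (i : ℕ) ≠ 0 := fun h => hi0 (Fin.ext h)
    have := i.isLt
    simp only [hT, mem_filter, mem_univ, true_and, hneg i hi0] at hi ⊢
    omega
  · have hmap : T.map Fin.valEmbedding =
        Icc 1 h ∪ (Ico (n - h) n ∪ (if k % 2 = 1 then {n / 2} else ∅)) := by
      have hn2 : k % 2 = 1 → n % 2 = 0 := by
        intro hk
        rcases Nat.even_mul.1 he with h | h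
        · exact Nat.even_iff.1 h
        · have := Nat.even_iff.1 h
          omega
      ext x
      simp only [mem_map, hT, mem_filter, mem_univ, true_and, Fin.valEmbedding_apply, mem_union,
        mem_Icc, mem_Ico]
      constructor
      · rintro ⟨i, hi, rfl⟩
        have := i.isLt
        split_ifs with hk
        · simp only [mem_singleton]; omega
        · simp only [notMem_empty, or_false]; omega
      · intro hx
        have hxn : x < n := by
          split_ifs at hx with hk
          · simp only [mem_singleton] at hx; omega
          · simp only [notMem_empty, or_false] at hx; omega
        refine ⟨⟨x, hxn⟩, ?_, rfl⟩
        simp only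
        split_ifs at hx with hk
        · simp only [mem_singleton] at hx
          have := hn2 hk
          omega
        · simp only [notMem_empty, or_false] at hx; omega
    rw [← card_map Fin.valEmbedding, hmap, card_union_of_disjoint, card_union_of_disjoint,
      Nat.card_Icc, Nat.card_Ico]
    · split_ifs with hk
      · rw [card_singleton]; omega
      · rw [card_empty]; omega
    · rw [Finset.disjoint_left]
      intro x hx
      rw [mem_Ico] at hx
      split_ifs with hk
      · rw [mem_singleton]; omega
      · simp
    · rw [Finset.disjoint_left]
      intro x hx
      rw [mem_Icc] at hx
      rw [mem_union, mem_Ico]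
      split_ifs with hk
      · rw [mem_singleton]; omega
      · simp only [notMem_empty, or_false]; omega

theorem coe_regulars_fin (n k : ℕ) : (regulars (Fin n) k : Set (SimpleGraph (Fin n))) =
    regularGraphs n k := by
  ext G
  rw [mem_coe, mem_regulars]
  refine forall_congr' fun v => ?_
  rw [← SimpleGraph.card_neighborFinset_eq_degree]
  have : nbrs G v = G.neighborFinset v := by ext u; simp
  rw [this]

theorem regularProb_eq (n k : ℕ) (Q : SimpleGraph (Fin n) → Prop) :
    regularProb n k Q = (#{G ∈ regulars (Fin n) k | Q G} : ℝ) / #(regulars (Fin n) k) := by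
  unfold regularProb
  rw [← coe_regulars_fin, Set.ncard_coe_finset]
  congr 2
  rw [← Set.ncard_coe_finset]
  congr 1
  ext G
  simp

theorem regularProb_le_one (n k : ℕ) (Q : SimpleGraph (Fin n) → Prop) :
    regularProb n k Q ≤ 1 := by
  rw [regularProb_eq]
  refine div_le_one_of_le₀ ?_ (Nat.cast_nonneg _)
  exact_mod_cast card_filter_le _ _

theorem regularProb_mono {n k : ℕ} {Q R : SimpleGraph (Fin n) → Prop} (h : ∀ G, Q G → R G) :
    regularProb n k Q ≤ regularProb n k R := by
  rw [regularProb_eq, regularProb_eq]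
  refine div_le_div_of_nonneg_right ?_ (Nat.cast_nonneg _)
  refine Nat.cast_le.2 (card_le_card fun G hG => ?_)
  rw [mem_filter] at hG ⊢
  exact ⟨hG.1, h G hG.2⟩

theorem RegularWhp.mono {k : ℕ} {Q R : ∀ n : ℕ, SimpleGraph (Fin n) → Prop}
    (hQ : RegularWhp k Q) (h : ∀ᶠ n in Filter.atTop, ∀ G, Q n G → R n G) : RegularWhp k R := by
  refine tendsto_of_tendsto_of_tendsto_of_le_of_le' hQ tendsto_const_nhds ?_
    (Filter.Eventually.of_forall fun n => regularProb_le_one n k _)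
  filter_upwards [h.filter_mono inf_le_left] with n hn
  exact regularProb_mono hn

/-- As `k / (2 * d) ≥ 2 * δ`, the tail factor is at most `exp (-2 δ) ≤ 4 ^ (-δ)`, leaving `2 ^ (-δ)`
to beat the polynomial `4 * d * k ^ 2`. Both `d` and `4096` are at most `2 ^ T`, and `T` is tiny
compared with `δ`. -/
theorem local_lemma_condition {d k δ T : ℕ} (hd : 0 < d) (hk4 : 4 * d * δ ≤ k)
    (hk8 : k ≤ 8 * d * δ) (hT : 24576 * T ≤ δ) (hT2 : 2 * (4608 * d) ^ 2 ≤ 2 ^ T) :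
    4 * (d * (2 ^ δ * (1 - 1 / (2 * d : ℝ)) ^ k)) * (k ^ 2 : ℕ) ≤ 1 := by
  have hd0 : (0 : ℝ) < d := by exact_mod_cast hd
  have hd1 : (1 : ℝ) ≤ d := by exact_mod_cast hd
  have hpow : (1 - 1 / (2 * d : ℝ)) ^ k ≤ (1 / 4) ^ δ := by
    have h0 : (0 : ℝ) ≤ 1 - 1 / (2 * d) := by
      have : 1 / (2 * d : ℝ) ≤ 1 := by
        rw [div_le_one (by positivity)]; linarith
      linarith
    have h1 : (1 - 1 / (2 * d : ℝ)) ≤ Real.exp (-(1 / (2 * d))) := by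
      have := Real.add_one_le_exp (-(1 / (2 * d : ℝ)))
      linarith
    have h2 : (2 * δ : ℝ) ≤ k * (1 / (2 * d)) := by
      rw [mul_one_div, le_div_iff₀ (by positivity)]
      have : (4 * d * δ : ℝ) ≤ k := by exact_mod_cast hk4
      linarith
    have h3 : Real.exp (-1) ≤ 1 / 2 := by
      rw [Real.exp_neg, one_div]
      have := Real.add_one_le_exp (1 : ℝ)
      exact inv_anti₀ (by norm_num) (by linarith)
    calc (1 - 1 / (2 * d : ℝ)) ^ k ≤ Real.exp (-(1 / (2 * d))) ^ k := pow_le_pow_left₀ h0 h1 _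
      _ = Real.exp (k * (-(1 / (2 * d)))) := by rw [Real.exp_nat_mul]
      _ ≤ Real.exp (((2 * δ : ℕ) : ℝ) * (-1)) := by
          rw [Real.exp_le_exp]
          push_cast
          linarith
      _ = Real.exp (-1) ^ (2 * δ) := by rw [Real.exp_nat_mul]
      _ ≤ (1 / 2) ^ (2 * δ) := pow_le_pow_left₀ (Real.exp_pos _).le h3 _
      _ = (1 / 4) ^ δ := by rw [pow_mul]; norm_num
  have hdT : d ≤ 2 ^ T := by nlinarith
  have h4096 : 4096 ≤ 2 ^ T := by nlinarith
  have hr : δ ≤ 4 * 2 ^ (δ / 4) := by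
    have := Nat.lt_two_pow_self (n := δ / 4)
    omega
  have hnat : 4 * d * k ^ 2 ≤ 2 ^ δ := by
    calc 4 * d * k ^ 2 ≤ 4 * d * (8 * d * δ) ^ 2 := by gcongr
      _ = 256 * (d * d * d) * (δ * δ) := by ring
      _ ≤ 256 * (2 ^ T * 2 ^ T * 2 ^ T) * ((4 * 2 ^ (δ / 4)) * (4 * 2 ^ (δ / 4))) := by gcongr
      _ = 4096 * (2 ^ T * 2 ^ T * 2 ^ T * (2 ^ (δ / 4) * 2 ^ (δ / 4))) := by ring
      _ ≤ 2 ^ T * (2 ^ T * 2 ^ T * 2 ^ T * (2 ^ (δ / 4) * 2 ^ (δ / 4))) := by gcongr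
      _ = 2 ^ (T + (T + T + T + (δ / 4 + δ / 4))) := by simp only [pow_add]
      _ ≤ 2 ^ δ := Nat.pow_le_pow_right (by norm_num) (by omega)
  have hreal : (4 : ℝ) * d * (k ^ 2 : ℕ) ≤ 2 ^ δ := by exact_mod_cast hnat
  calc 4 * (d * (2 ^ δ * (1 - 1 / (2 * d : ℝ)) ^ k)) * (k ^ 2 : ℕ)
      ≤ 4 * (d * (2 ^ δ * (1 / 4) ^ δ)) * (k ^ 2 : ℕ) := by gcongr
    _ = 4 * d * (k ^ 2 : ℕ) * (1 / 2) ^ δ := by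
        rw [← mul_pow]; norm_num; ring
    _ ≤ 2 ^ δ * (1 / 2) ^ δ := by gcongr
    _ = 1 := by rw [← mul_pow]; norm_num

theorem le_regularProb_strongRigidPartition {n d k δ T : ℕ} (hd : 0 < d) (hk4 : 4 * d * δ ≤ k)
    (hk8 : k ≤ 8 * d * δ) (hT : 24576 * T ≤ δ) (hT2 : 2 * (4608 * d) ^ 2 ≤ 2 ^ T)
    (hn : 768 * d * (8 * (2 * k + 1)) ≤ n) (he : Even (n * k)) :
    1 - (192 * d / n + (1 / 2 : ℝ) ^ (n / (768 * d))) ≤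
      regularProb n k (fun G => AdmitsStrongRigidPartition G d) := by
  -- The largest `w` that the sparsity estimate allows; it is still of order `n / d`, as the
  -- estimate for joinedness needs.
  set w := n / (768 * d) with hw
  have hT0 : 0 < T := by
    rcases Nat.eq_zero_or_pos T with rfl | h
    · simp only [pow_zero] at hT2; nlinarith
    · exact h
  have hδ4 : 4 ≤ δ := by omega
  have hk0 : 0 < k := by nlinarith
  have hwle : 768 * d * w ≤ n := Nat.mul_div_le n (768 * d)
  have hw8 : 8 * (2 * k + 1) ≤ w := by
    rw [hw, Nat.le_div_iff_mul_le (by positivity), mul_comm]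
    exact hn
  have hnw : n ≤ 1536 * d * w := by
    have h1 : n < 768 * d * (w + 1) := by
      rw [mul_comm]; exact Nat.lt_mul_of_div_lt (Nat.lt_succ_self _) (by positivity)
    have h2 : 768 * d * (w + 1) ≤ 768 * d * (2 * w) := Nat.mul_le_mul_left _ (by omega)
    calc n ≤ 768 * d * (2 * w) := by omega
      _ = 1536 * d * w := by ring
  have hn8 : 8 * (k + 1) ≤ n := by nlinarith
  have : Nonempty (Fin n) := ⟨⟨0, by omega⟩⟩
  have hδd : 4608 * d ≤ 2 ^ δ := by
    have h1 : (2 : ℕ) ^ T ≤ 2 ^ δ := Nat.pow_le_pow_right (by norm_num) (by omega)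
    nlinarith
  have hN : (0 : ℝ) < #(regulars (Fin n) k) := by
    exact_mod_cast card_pos.2 (regulars_fin_nonempty (by omega) he)
  have hb1 := card_not_locallySparse_le (V := Fin n) (w := w) hd hk8 hk4 hδ4
    (by rwa [Fintype.card_fin]) (by rwa [Fintype.card_fin]) hδd
  have hb2 := card_locallySparse_not_joined_le (V := Fin n) (w := w) hd hk4 (by omega) hw8
    (by rwa [Fintype.card_fin]) hT hT2
  rw [Fintype.card_fin] at hb1
  have hcov : regulars (Fin n) k ⊆
      {G ∈ regulars (Fin n) k | AdmitsStrongRigidPartition G d} ∪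
      ({G ∈ regulars (Fin n) k | ¬ LocallySparse G δ w} ∪
        {G ∈ regulars (Fin n) k | LocallySparse G δ w ∧ ¬ Joined G w}) := by
    intro G hG
    simp only [mem_union, mem_filter, hG, true_and]
    by_cases h1 : LocallySparse G δ w
    · by_cases h2 : Joined G w
      · obtain ⟨f, hf⟩ := exists_balanced_colouring hd hk0 (mem_regulars.1 hG)
          (local_lemma_condition hd hk4 hk8 hT hT2)
        exact Or.inl (strongRigidPartition_of_colouring (by omega) h1 h2 hf)
      · exact Or.inr (Or.inr ⟨h1, h2⟩)
    · exact Or.inr (Or.inl h1)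
  have hsum := (card_le_card hcov).trans ((card_union_le _ _).trans
    (Nat.add_le_add_left (card_union_le _ _) _))
  have hsum' : (#(regulars (Fin n) k) : ℝ) ≤
      #{G ∈ regulars (Fin n) k | AdmitsStrongRigidPartition G d} +
      (#{G ∈ regulars (Fin n) k | ¬ LocallySparse G δ w} +
        #{G ∈ regulars (Fin n) k | LocallySparse G δ w ∧ ¬ Joined G w}) := by
    exact_mod_cast hsum
  rw [regularProb_eq, le_div_iff₀ hN]
  linarith

theorem regularWhp_strongRigidPartition {d k δ T : ℕ} (hd : 0 < d) (hk4 : 4 * d * δ ≤ k)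
    (hk8 : k ≤ 8 * d * δ) (hT : 24576 * T ≤ δ) (hT2 : 2 * (4608 * d) ^ 2 ≤ 2 ^ T) :
    RegularWhp k (fun _ G => AdmitsStrongRigidPartition G d) := by
  have hlim : Filter.Tendsto (fun n : ℕ => 1 - (192 * d / n + (1 / 2 : ℝ) ^ (n / (768 * d))))
      Filter.atTop (nhds 1) := by
    have h1 : Filter.Tendsto (fun n : ℕ => (192 * d / n : ℝ)) Filter.atTop (nhds 0) :=
      tendsto_const_div_atTop_nhds_zero_nat _
    have h2 : Filter.Tendsto (fun n : ℕ => (1 / 2 : ℝ) ^ (n / (768 * d))) Filter.atTop (nhds 0) :=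
      (tendsto_pow_atTop_nhds_zero_of_lt_one (by norm_num) (by norm_num)).comp
        (Nat.tendsto_div_const_atTop (by positivity))
    simpa using tendsto_const_nhds.sub (h1.add h2)
  refine tendsto_of_tendsto_of_tendsto_of_le_of_le' (hlim.mono_left inf_le_left)
    tendsto_const_nhds ?_ (Filter.Eventually.of_forall fun n => regularProb_le_one n k _)
  have h1 : ∀ᶠ n : ℕ in Filter.atTop ⊓ Filter.principal {n : ℕ | Even (n * k)},
      768 * d * (8 * (2 * k + 1)) ≤ n :=
    (Filter.eventually_ge_atTop _).filter_mono inf_le_left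
  have h2 : ∀ᶠ n : ℕ in Filter.atTop ⊓ Filter.principal {n : ℕ | Even (n * k)},
      Even (n * k) := Filter.mem_inf_of_right (Filter.mem_principal_self _)
  filter_upwards [h1, h2] with n hn he
  exact le_regularProb_strongRigidPartition hd hk4 hk8 hT hT2 hn he

/-- The constant is `8 * 24576 * 60`: it gives `T + 1 ≥ 60 * log d`, and since `log 2 ≥ 1 / 2` this
yields `2 ^ (T + 1) ≥ d ^ 30 ≥ 2 ^ 28 * d ^ 2`, which exceeds `4 * (4608 * d) ^ 2`. -/
theorem exists_parameters {d k : ℕ} (hd : 2 ≤ d) (hk : 11796480 * d * Real.log d ≤ k) :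
    ∃ δ T : ℕ, 4 * d * δ ≤ k ∧ k ≤ 8 * d * δ ∧ 24576 * T ≤ δ ∧ 2 * (4608 * d) ^ 2 ≤ 2 ^ T := by
  have hd2 : (2 : ℝ) ≤ d := by exact_mod_cast hd
  have hd0 : (0 : ℝ) < d := by linarith
  have hlog2 : 1 / 2 ≤ Real.log 2 := by
    have := Real.log_two_gt_d9; linarith
  have hlogd : 1 / 2 ≤ Real.log d := hlog2.trans (Real.log_le_log (by norm_num) hd2)
  have hk8d : 8 * d ≤ k := by
    have : (8 * d : ℝ) ≤ k := by nlinarith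
    exact_mod_cast this
  -- The `+ 1` secures `k ≤ 8 * d * δ`; it is harmless for `4 * d * δ ≤ k` because `8 * d ≤ k`.
  set δ := k / (8 * d) + 1 with hδ
  set T := δ / 24576 with hT
  have hdiv : 8 * d * (k / (8 * d)) ≤ k := Nat.mul_div_le _ _
  have hkδ : k ≤ 8 * d * δ := by
    rw [hδ, mul_comm]
    exact (Nat.lt_mul_of_div_lt (Nat.lt_succ_self _) (by positivity)).le
  refine ⟨δ, T, ?_, hkδ, Nat.mul_div_le _ _, ?_⟩
  · have : 4 * d * δ * 2 = 8 * d * (k / (8 * d)) + 8 * d := by rw [hδ]; ring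
    omega
  · have h1 : δ ≤ 24576 * (T + 1) := by
      have := Nat.lt_mul_of_div_lt (Nat.lt_succ_self (δ / 24576)) (by norm_num : 0 < 24576)
      omega
    have h2 : 60 * Real.log d ≤ (T + 1 : ℕ) := by
      have h3 : (k : ℝ) ≤ 8 * d * δ := by exact_mod_cast hkδ
      have h4 : (δ : ℝ) ≤ 24576 * (T + 1 : ℕ) := by exact_mod_cast h1
      have h5 : 11796480 * d * Real.log d ≤ 8 * d * (24576 * (T + 1 : ℕ)) :=
        hk.trans (h3.trans (by gcongr))
      have h6 : d * (60 * Real.log d) ≤ d * (T + 1 : ℕ) := by linarith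
      exact le_of_mul_le_mul_left h6 hd0
    have h7 : (d : ℝ) ^ 30 ≤ 2 ^ (T + 1) := by
      rw [← Real.log_le_log_iff (by positivity) (by positivity), Real.log_pow, Real.log_pow]
      calc ((30 : ℕ) : ℝ) * Real.log d = 60 * Real.log d * (1 / 2) := by push_cast; ring
        _ ≤ (T + 1 : ℕ) * Real.log 2 := by gcongr
    have h8 : d ^ 30 ≤ 2 ^ (T + 1) := by exact_mod_cast h7
    have h9 : 2 ^ 28 * d ^ 2 ≤ d ^ 30 := by
      calc 2 ^ 28 * d ^ 2 ≤ d ^ 28 * d ^ 2 := by gcongr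
        _ = d ^ 30 := by ring
    have h10 : 2 ^ (T + 1) = 2 * 2 ^ T := by ring
    have h11 : 2 * (2 * (4608 * d) ^ 2) ≤ 2 ^ 28 * d ^ 2 := by
      have : 2 * (2 * (4608 * d) ^ 2) = 84934656 * d ^ 2 := by ring
      rw [this]
      gcongr
      norm_num
    omega

end RandomRegular

end RigidPartition

theorem theorem1p6 :
    ∃ C : ℝ, 0 < C ∧ ∀ d k : ℕ, 2 ≤ d → C * d * Real.log d ≤ k →
      RigidPartition.RegularWhp k
        (fun _ G => RigidPartition.AdmitsStrongRigidPartition G d) ∧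
      RigidPartition.RegularWhp k
        (fun _ G => RigidPartition.IsRigid G d) := by
  refine ⟨11796480, by norm_num, fun d k hd hk => ?_⟩
  obtain ⟨δ, T, hk4, hk8, hT, hT2⟩ := RigidPartition.exists_parameters hd hk
  have h := RigidPartition.regularWhp_strongRigidPartition (by omega) hk4 hk8 hT hT2
  refine ⟨h, h.mono ?_⟩
  filter_upwards [Filter.eventually_ge_atTop (d + 1)] with n hn G hG
  exact hG.isRigid (by rwa [Fintype.card_fin])
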